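/- **Theorem 1.1.** Consider a branching random walk on $\mathbb{R}$: it starts from one particle at $0$, and every particle, independently of all others, produces children whose displacements from their parent form a point process with a fixed law (the number of children may be infinite). Write $|u|$ and $S_u$ for the generation and the position of a particle $u$. Assume that the walk is supercritical, $\mathbb{E}[\#\{u : |u|=1\}]>1$, and non-degenerate, i.e. $\mathbb{P}(\exists u: |u|=1,\ S_u\neq x)>0$ for every $x\in\mathbb{R}$. Let $$\kappa(\theta)=\log \mathbb{E}\Big[\sum_{|u|=1}e^{\theta S_u}\Big]\in(-\infty,\infty],\qquad W_n(\theta)=\sum_{|u|=n}e^{\theta S_u-n\kappa(\theta)} .$$ Fix $\theta>0$ such that $\kappa(\theta)<\infty$ and such that $(W_n(\theta))_{n\ge 0}$ is uniformly integrable. Let $\nu$ be a probability measure on $\mathbb{R}$ for which there is a constant $L\in(0,\infty)$ with $$\nu([x,\infty))\sim L e^{-\theta x}\qquad (x\to\infty).$$ Let $(Y_u)$ be i.i.d. random variables of law $\nu$, indexed by the particles and independent of the branching random walk, and put $$\mathcal{E}_n=\sum_{|u|=n}\delta_{S_u+Y_u},\qquad m_n=n\frac{\kappa(\theta)}{\theta}+\frac1\theta\log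 L .$$ Then $W_n(\theta)$ converges almost surely to a finite limit $W_\infty(\theta)$, each $\mathcal{E}_n$ is almost surely a locally finite point measure, and, as $n\to\infty$, the shifted point measures $\tau_{-m_n}\mathcal{E}_n=\sum_{|u|=n}\delta_{S_u+Y_u-m_n}$ converge in law, in the space of locally finite point measures on $\mathbb{R}$ with the topology of vague convergence, to a Cox process $\mathrm{PPP}(\theta W_\infty(\theta)e^{-\theta x}\,dx)$, that is, a point process which conditionally on a random variable $Q$ distributed as $W_\infty(\theta)$ is a Poisson point process with intensity measure $\theta Q e^{-\theta x}\,dx$. -/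

import Mathlib

open MeasureTheory ProbabilityTheory Filter Topology
open scoped ENNReal NNReal CompactlySupported

noncomputable section

namespace LPM

/-! ### Point measures on the line and the vague topology -/

/-- A point measure on `ℝ`: a locally finite Borel measure taking values in `{0, 1, 2, …, ∞}`. -/
def IsPointMeasure (μ : Measure ℝ) : Prop :=
  IsLocallyFiniteMeasure μ ∧ ∀ B : Set ℝ, MeasurableSet B → ∃ k : ℕ∞, μ B = (k : ℝ≥0∞)

/-- The set of point measures on `ℝ`. -/
def PointMeasure : Type := {μ : Measure ℝ // IsPointMeasure μ}

namespace PointMeasure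

/-- The topology of vague convergence: the coarsest topology for which `μ ↦ ∫ φ dμ` is continuous
for every continuous compactly supported `φ : ℝ → ℝ`. -/
instance : TopologicalSpace PointMeasure :=
  ⨅ φ : C_c(ℝ, ℝ), TopologicalSpace.induced (fun μ : PointMeasure => ∫ x, φ x ∂μ.1) inferInstance

/-- The Borel σ-algebra of the vague topology. -/
instance : MeasurableSpace PointMeasure := borel PointMeasure

instance : BorelSpace PointMeasure := ⟨rfl⟩

end PointMeasure

theorem isPointMeasure_zero : IsPointMeasure 0 :=
  ⟨inferInstance, fun _ _ => ⟨0, by simp⟩⟩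

open Classical in
/-- A point measure regarded as an element of the space `PointMeasure`; measures that are not point
measures are sent to the zero measure (this is used for random measures that are almost surely
point measures, where the convention matters on a null set only). -/
def toPointMeasure (μ : Measure ℝ) : PointMeasure :=
  if h : IsPointMeasure μ then ⟨μ, h⟩ else ⟨0, isPointMeasure_zero⟩

/-- The shift `τ_x` of a measure: an atom at `z` is moved to `z + x`. -/
def shift (x : ℝ) (μ : Measure ℝ) : Measure ℝ := μ.map (fun z => z + x)

/-! ### Cox processes -/

/-- `Z` is a Cox process `PPP(Q μ)`: conditionally on `Q`, the numbers of points of `Z` in pairwise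
disjoint bounded Borel sets `B i` are independent Poisson variables with means `Q * μ (B i)`. -/
structure IsCoxProcess {Ω : Type*} [MeasurableSpace Ω] (P : Measure Ω) (Q : Ω → ℝ≥0)
    (μ : Measure ℝ) (Z : Ω → PointMeasure) : Prop where
  measurable_intensity : Measurable Q
  measurable_process : Measurable Z
  condProb_eq : ∀ (k : ℕ) (B : Fin k → Set ℝ),
    (∀ i, MeasurableSet (B i)) → (∀ i, Bornology.IsBounded (B i)) →
    (∀ i j, i ≠ j → Disjoint (B i) (B j)) → ∀ c : Fin k → ℕ,
      P⟦{ω | ∀ i, (Z ω).1 (B i) = (c i : ℝ≥0∞)} | MeasurableSpace.comap Q inferInstance⟧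
        =ᵐ[P] fun ω => ∏ i, (poissonMeasure (Q ω * (μ (B i)).toNNReal)).real {c i}

/-! ### The branching random walk

Potential particles are labelled by finite words of integers, the root being `[]` and `i :: u` being
the `i`-th child of `u`. The particle `u` has `N u ∈ {0, 1, …, ∞}` children, namely `i :: u` with
`i < N u`, and the `i`-th of them is displaced by `ξ u i` from `u`. The variable `Y u` is the
perturbation attached to `u`. -/

variable {Ω : Type*}

/-- The word `u` is the label of a particle of the branching random walk. -/
def IsParticle (N : List ℕ → Ω → ℕ∞) (ω : Ω) : List ℕ → Prop
  | [] => True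
  | i :: u => IsParticle N ω u ∧ (i : ℕ∞) < N u ω

/-- The particles of generation `n`. -/
def generation (N : List ℕ → Ω → ℕ∞) (n : ℕ) (ω : Ω) : Set (List ℕ) :=
  {u | u.length = n ∧ IsParticle N ω u}

/-- The position `S_u` of the particle `u`. -/
def position (ξ : List ℕ → ℕ → Ω → ℝ) (ω : Ω) : List ℕ → ℝ
  | [] => 0
  | i :: u => position ξ ω u + ξ u i ω

/-- The reproduction of the particle `u`: its number of children and their displacements. -/
def offspring (N : List ℕ → Ω → ℕ∞) (ξ : List ℕ → ℕ → Ω → ℝ) (u : List ℕ) (ω : Ω) :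
    ℕ∞ × (ℕ → ℝ) :=
  (N u ω, fun i => ξ u i ω)

/-- `(N, ξ, Y)` drives a last progeny modified branching random walk with perturbation law `ν`:
the particles reproduce independently with the same reproduction law (the numbers of children and
the displacements inside one family being arbitrarily dependent), and the perturbations are i.i.d.
with law `ν` and independent of the branching random walk. -/
structure IsLastProgenyModifiedBRW [MeasurableSpace Ω] (P : Measure Ω)
    (N : List ℕ → Ω → ℕ∞) (ξ : List ℕ → ℕ → Ω → ℝ) (Y : List ℕ → Ω → ℝ) (ν : Measure ℝ) :
    Prop where
  measurable_offspring : ∀ u, Measurable (offspring N ξ u)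
  measurable_perturbation : ∀ u, Measurable (Y u)
  iIndepFun_offspring : iIndepFun (fun u => offspring N ξ u) P
  identDistrib_offspring : ∀ u, IdentDistrib (offspring N ξ u) (offspring N ξ []) P P
  iIndepFun_perturbation : iIndepFun Y P
  law_perturbation : ∀ u, P.map (Y u) = ν
  indepFun : IndepFun (fun ω u => offspring N ξ u ω) (fun ω u => Y u ω) P

/-- The log-Laplace transform `κ(θ) = log E[∑_{|u| = 1} exp(θ S_u)]`. -/
def kappa [MeasurableSpace Ω] (P : Measure Ω) (N : List ℕ → Ω → ℕ∞) (ξ : List ℕ → ℕ → Ω → ℝ)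
    (θ : ℝ) : EReal :=
  ENNReal.log
    (∫⁻ ω, ∑' u : generation N 1 ω, ENNReal.ofReal (Real.exp (θ * position ξ ω u.1)) ∂P)

/-- The additive martingale `W_n(θ) = ∑_{|u| = n} exp(θ S_u - n κ(θ))` (for `κ(θ)` finite). -/
def additiveMartingale [MeasurableSpace Ω] (P : Measure Ω) (N : List ℕ → Ω → ℕ∞)
    (ξ : List ℕ → ℕ → Ω → ℝ) (θ : ℝ) (n : ℕ) (ω : Ω) : ℝ≥0∞ :=
  ∑' u : generation N n ω,
    ENNReal.ofReal (Real.exp (θ * position ξ ω u.1 - n * (kappa P N ξ θ).toReal))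

/-- `W_∞(θ)`, the almost sure limit of `W_n(θ)`; it is defined everywhere as the upper limit. -/
def additiveLimit [MeasurableSpace Ω] (P : Measure Ω) (N : List ℕ → Ω → ℕ∞)
    (ξ : List ℕ → ℕ → Ω → ℝ) (θ : ℝ) (ω : Ω) : ℝ≥0∞ :=
  limsup (fun n => additiveMartingale P N ξ θ n ω) atTop

/-- The random measure `E_n = ∑_{|u| = n} δ_{S_u + Y_u}`. -/
def extremalMeasure (N : List ℕ → Ω → ℕ∞) (ξ : List ℕ → ℕ → Ω → ℝ) (Y : List ℕ → Ω → ℝ)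
    (n : ℕ) (ω : Ω) : Measure ℝ :=
  Measure.sum fun u : generation N n ω => Measure.dirac (position ξ ω u.1 + Y u.1 ω)

/-- The centring `m_n = n κ(θ) / θ + (log L) / θ`. -/
def centring [MeasurableSpace Ω] (P : Measure Ω) (N : List ℕ → Ω → ℕ∞)
    (ξ : List ℕ → ℕ → Ω → ℝ) (θ L : ℝ) (n : ℕ) : ℝ :=
  n * ((kappa P N ξ θ).toReal / θ) + 1 / θ * Real.log L

/-- The measure `θ exp(-θ x) dx` on `ℝ`. -/
def expIntensity (θ : ℝ) : Measure ℝ :=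
  volume.withDensity fun x => ENNReal.ofReal (θ * Real.exp (-θ * x))

end LPM

end

noncomputable section

namespace LPM

section

/-! ### Exponential moments of random walks on half-lines -/

theorem countable_setOf_exp_mul_eq {d : ℝ} (hd : d ≠ 0) :
    {t : ℝ | Complex.exp (t * d * Complex.I) = 1}.Countable := by
  refine (Set.countable_range fun n : ℤ => n * (2 * Real.pi) / d).mono fun t ht => ?_
  obtain ⟨n, hn⟩ := Complex.exp_eq_one_iff.1 ht
  refine ⟨n, ?_⟩
  have h : ((t * d : ℝ) : ℂ) = ((n * (2 * Real.pi) : ℝ) : ℂ) := by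
    have : (t * d * Complex.I : ℂ) = (n * (2 * Real.pi)) * Complex.I := by rw [hn]; ring
    have := mul_right_cancel₀ Complex.I_ne_zero this
    push_cast; exact this
  have := Complex.ofReal_injective h
  field_simp
  linarith

theorem ae_norm_charFun_lt_one (μ γ : Measure ℝ) [IsProbabilityMeasure μ] [IsProbabilityMeasure γ]
    [NullSingletonClass γ] (hμ : ∀ x, μ {x}ᶜ ≠ 0) : ∀ᵐ t ∂γ, ‖charFun μ t‖ < 1 := by
  have hms : MeasurableSet {p : ℝ × ℝ × ℝ | p.2.1 ≠ p.2.2 →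
      Complex.exp (p.1 * (p.2.1 - p.2.2 : ℝ) * Complex.I) ≠ 1} := by
    have h1 : MeasurableSet {p : ℝ × ℝ × ℝ | p.2.1 = p.2.2} :=
      measurableSet_eq_fun (by fun_prop) (by fun_prop)
    have h2 : MeasurableSet {p : ℝ × ℝ × ℝ |
        Complex.exp (p.1 * (p.2.1 - p.2.2 : ℝ) * Complex.I) = 1} :=
      measurableSet_eq_fun (by fun_prop) (by fun_prop)
    convert h1.union h2.compl using 1
    ext p
    simp only [Set.mem_ofPred_eq, Set.mem_union, Set.mem_compl_iff]
    tauto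
  have h : ∀ᵐ p ∂(γ.prod (μ.prod μ)), p.2.1 ≠ p.2.2 →
      Complex.exp (p.1 * (p.2.1 - p.2.2 : ℝ) * Complex.I) ≠ 1 := by
    have hms' := hms.preimage (measurable_swap (α := ℝ × ℝ) (β := ℝ))
    have : ∀ᵐ q ∂((μ.prod μ).prod γ), q.1.1 ≠ q.1.2 →
      Complex.exp (q.2 * (q.1.1 - q.1.2 : ℝ) * Complex.I) ≠ 1 := by
      refine (Measure.ae_prod_iff_ae_ae hms').2 ?_
      refine ae_of_all _ fun p => ?_
      by_cases hp : p.1 = p.2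
      · exact ae_of_all _ fun t h => (h hp).elim
      · have hc := countable_setOf_exp_mul_eq (sub_ne_zero.2 hp)
        filter_upwards [hc.ae_notMem γ] with t ht _ using ht
    rw [← Measure.prod_swap] at this
    exact (ae_map_iff measurable_swap.aemeasurable hms').1 this
  have h2 := Measure.ae_ae_of_ae_prod h
  filter_upwards [h2] with t ht
  have hle : ∀ᵐ x : ℝ ∂μ, ‖Complex.exp (t * x * Complex.I)‖ ≤ 1 :=
    ae_of_all _ fun x => by
      rw [show (t * x * Complex.I : ℂ) = ((t * x : ℝ) : ℂ) * Complex.I by push_cast; ring,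
        Complex.norm_exp_ofReal_mul_I]
  rcases ae_eq_const_or_norm_integral_lt_of_norm_le_const hle with hc | hc
  · exfalso
    set c := ⨍ x : ℝ, Complex.exp (t * x * Complex.I) ∂μ
    have hc' : ∀ᵐ x : ℝ ∂μ, Complex.exp (t * x * Complex.I) = c := hc
    have h3 := Measure.ae_ae_of_ae_prod ht
    obtain ⟨x, hx1, hx2⟩ := (h3.and hc').exists
    apply hμ x
    suffices h4 : ∀ᵐ y ∂μ, y = x from ae_iff.1 h4
    filter_upwards [hx1, hc'] with y hy hyc
    by_contra hne
    refine hy (Ne.symm hne) ?_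
    have : (t * (x - y : ℝ) * Complex.I : ℂ) = t * x * Complex.I - t * y * Complex.I := by
      push_cast; ring
    rw [this, Complex.exp_sub, hx2, hyc, div_self]
    rw [← hyc]
    exact Complex.exp_ne_zero _
  · rw [charFun_apply_real]
    simpa using hc

theorem exp_mul_measure_Icc_le (M : Measure ℝ) [IsProbabilityMeasure M] (a b : ℝ) :
    Real.exp (-(b - a) ^ 2 / 2) * M.real (Set.Icc a b)
      ≤ ∫ t, ‖charFun M t‖ ∂(gaussianReal 0 1) := by
  have h1 : ∀ x : ℝ, ∫ t, Complex.exp ((x - a : ℝ) * t * Complex.I) ∂(gaussianReal 0 1)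
      = (Real.exp (-(x - a) ^ 2 / 2) : ℝ) := fun x => by
    rw [← charFun_apply_real, charFun_gaussianReal]
    push_cast; congr 1; simp; ring
  have hnorm : ∀ x t : ℝ, ‖Complex.exp ((x - a : ℝ) * t * Complex.I)‖ = 1 := fun x t => by
    rw [← Complex.ofReal_mul, Complex.norm_exp_ofReal_mul_I]
  have hint : Integrable (Function.uncurry fun (x t : ℝ) =>
      Complex.exp ((x - a : ℝ) * t * Complex.I)) (M.prod (gaussianReal 0 1)) := by
    refine (integrable_const (1 : ℝ)).mono' (by fun_prop) (ae_of_all _ fun p => ?_)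
    exact (hnorm p.1 p.2).le
  have h2 : ((∫ x, Real.exp (-(x - a) ^ 2 / 2) ∂M : ℝ) : ℂ)
      = ∫ t, Complex.exp (-(a * t) * Complex.I) * charFun M t ∂(gaussianReal 0 1) := by
    rw [← integral_complex_ofReal]
    simp_rw [← h1]
    rw [integral_integral_swap hint]
    refine integral_congr_ae (ae_of_all _ fun t => ?_)
    simp only [charFun_apply_real]
    rw [← integral_const_mul]
    refine integral_congr_ae (ae_of_all _ fun x => ?_)
    simp only [← Complex.exp_add]
    congr 1; push_cast; ring
  have hi : Integrable (fun x : ℝ => Real.exp (-(x - a) ^ 2 / 2)) M := by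
    refine (integrable_const (1 : ℝ)).mono' (by fun_prop) (ae_of_all _ fun x => ?_)
    rw [Real.norm_eq_abs, abs_of_pos (Real.exp_pos _)]
    exact Real.exp_le_one_iff.2 (by nlinarith [sq_nonneg (x - a)])
  calc Real.exp (-(b - a) ^ 2 / 2) * M.real (Set.Icc a b)
      = ∫ x in Set.Icc a b, Real.exp (-(b - a) ^ 2 / 2) ∂M := by
        rw [setIntegral_const, smul_eq_mul, mul_comm]
    _ ≤ ∫ x in Set.Icc a b, Real.exp (-(x - a) ^ 2 / 2) ∂M := by
        refine setIntegral_mono_on (by simp) hi.integrableOn measurableSet_Icc fun x hx => ?_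
        refine Real.exp_le_exp.2 ?_
        have : (x - a) ^ 2 ≤ (b - a) ^ 2 := by
          apply pow_le_pow_left₀ <;> linarith [hx.1, hx.2]
        linarith
    _ ≤ ∫ x, Real.exp (-(x - a) ^ 2 / 2) ∂M :=
        setIntegral_le_integral hi (ae_of_all _ fun x => (Real.exp_pos _).le)
    _ = ‖((∫ x, Real.exp (-(x - a) ^ 2 / 2) ∂M : ℝ) : ℂ)‖ := by
        rw [Complex.norm_real, Real.norm_eq_abs, abs_of_nonneg]
        exact integral_nonneg fun x => (Real.exp_pos _).le
    _ ≤ ∫ t, ‖charFun M t‖ ∂(gaussianReal 0 1) := by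
        rw [h2]
        refine (norm_integral_le_integral_norm _).trans (le_of_eq ?_)
        congr 1; ext t
        rw [norm_mul, show (-(a * t) * Complex.I : ℂ) = ((-(a * t) : ℝ) : ℂ) * Complex.I by
          push_cast; ring, Complex.norm_exp_ofReal_mul_I, one_mul]

/-- The law of a random walk with non-degenerate steps spreads out: bounded intervals lose all
their mass. -/
theorem tendsto_measure_Icc_of_charFun_eq_pow (μ : Measure ℝ) [IsProbabilityMeasure μ]
    (hμ : ∀ x, μ {x}ᶜ ≠ 0) (M : ℕ → Measure ℝ) [∀ n, IsProbabilityMeasure (M n)]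
    (hM : ∀ n t, charFun (M n) t = charFun μ t ^ n) (a b : ℝ) :
    Tendsto (fun n => M n (Set.Icc a b)) atTop (𝓝 0) := by
  have : NullSingletonClass (gaussianReal 0 1) := nullSingletonClass_gaussianReal one_ne_zero
  have h : Tendsto (fun n : ℕ => ∫ t, ‖charFun μ t‖ ^ n ∂(gaussianReal 0 1)) atTop
      (𝓝 (∫ t, 0 ∂(gaussianReal 0 1))) := by
    refine tendsto_integral_of_dominated_convergence (fun _ => 1)
      (fun n => (by fun_prop : Measurable fun t => ‖charFun μ t‖ ^ n).aestronglyMeasurable)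
      (integrable_const _)
      (fun n => ae_of_all _ fun t => ?_) ?_
    · rw [norm_pow, norm_norm]
      exact pow_le_one₀ (norm_nonneg _) (norm_charFun_le_one t)
    · filter_upwards [ae_norm_charFun_lt_one μ (gaussianReal 0 1) hμ] with t ht
      exact tendsto_pow_atTop_nhds_zero_of_lt_one (norm_nonneg _) ht
  rw [integral_zero] at h
  have h' := h.const_mul (Real.exp (-(b - a) ^ 2 / 2))⁻¹
  rw [mul_zero] at h'
  have h2 : Tendsto (fun n => (M n).real (Set.Icc a b)) atTop (𝓝 0) := by
    refine squeeze_zero (fun n => measureReal_nonneg) (fun n => ?_) h'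
    rw [← div_eq_inv_mul, le_div_iff₀ (Real.exp_pos _), mul_comm]
    refine (exp_mul_measure_Icc_le (M n) a b).trans (le_of_eq ?_)
    simp_rw [hM, norm_pow]
  have := ENNReal.tendsto_ofReal h2
  simpa using this

theorem tendsto_lintegral_exp_neg_Ici (μ : Measure ℝ) [IsProbabilityMeasure μ]
    (hμ : ∀ x, μ {x}ᶜ ≠ 0) (M : ℕ → Measure ℝ) [∀ n, IsProbabilityMeasure (M n)]
    (hM : ∀ n t, charFun (M n) t = charFun μ t ^ n) (c : ℝ) :
    Tendsto (fun n => ∫⁻ x in Set.Ici c, ENNReal.ofReal (Real.exp (-x)) ∂(M n)) atTop (𝓝 0) := by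
  rw [ENNReal.tendsto_nhds_zero]
  intro ε hε
  have h1 : Tendsto (fun d : ℝ => ENNReal.ofReal (Real.exp (-d))) atTop (𝓝 0) := by
    have := ENNReal.tendsto_ofReal (Real.tendsto_exp_neg_atTop_nhds_zero)
    simpa using this
  obtain ⟨d, hd⟩ := (ENNReal.tendsto_nhds_zero.1 h1 (ε / 2) (ENNReal.half_pos hε.ne')).exists
  have h2 := ENNReal.Tendsto.const_mul (tendsto_measure_Icc_of_charFun_eq_pow μ hμ M hM c d)
    (a := ENNReal.ofReal (Real.exp (-c))) (Or.inr ENNReal.ofReal_ne_top)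
  rw [mul_zero] at h2
  filter_upwards [ENNReal.tendsto_nhds_zero.1 h2 (ε / 2) (ENNReal.half_pos hε.ne')] with n hn
  calc ∫⁻ x in Set.Ici c, ENNReal.ofReal (Real.exp (-x)) ∂(M n)
      ≤ ∫⁻ x in Set.Icc c d ∪ Set.Ici d, ENNReal.ofReal (Real.exp (-x)) ∂(M n) := by
        refine lintegral_mono_set fun x hx => ?_
        rcases le_total x d with h | h
        · exact Or.inl ⟨hx, h⟩
        · exact Or.inr h
    _ ≤ _ := lintegral_union_le _ _ _
    _ ≤ ENNReal.ofReal (Real.exp (-c)) * M n (Set.Icc c d)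
        + ENNReal.ofReal (Real.exp (-d)) * M n (Set.Ici d) := by
        rw [← setLIntegral_const, ← setLIntegral_const]
        refine add_le_add (setLIntegral_mono measurable_const fun x hx => ?_)
          (setLIntegral_mono measurable_const fun x hx => ?_)
        · exact ENNReal.ofReal_le_ofReal (Real.exp_le_exp.2 (neg_le_neg hx.1))
        · exact ENNReal.ofReal_le_ofReal (Real.exp_le_exp.2 (neg_le_neg hx))
    _ ≤ ε / 2 + ε / 2 * 1 := by
        gcongr
        exact prob_le_one
    _ = ε := by rw [mul_one, ENNReal.add_halves]

end

section

/-! ### The vague topology and characteristic functionals -/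

/-- A continuous cutoff, equal to `1` on `[-k, k]` and to `0` outside `[-k-1, k+1]`. -/
def cutoff (k : ℕ) : C_c(ℝ, ℝ) where
  toFun x := max 0 (min 1 (k + 1 - |x|))
  continuous_toFun := by fun_prop
  hasCompactSupport' := by
    refine HasCompactSupport.intro (isCompact_Icc (a := -(k + 1 : ℝ)) (b := k + 1)) fun x hx => ?_
    have : (k + 1 : ℝ) < |x| := by
      by_contra! h
      exact hx (abs_le.1 h)
    rw [max_eq_left]
    exact (min_le_right _ _).trans (by linarith)

theorem cutoff_nonneg (k : ℕ) (x : ℝ) : 0 ≤ cutoff k x := le_max_left _ _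

theorem cutoff_eq_one {k : ℕ} {x : ℝ} (hx : |x| ≤ k) : cutoff k x = 1 := by
  change max 0 (min 1 (k + 1 - |x|)) = 1
  rw [min_eq_left (by linarith), max_eq_right zero_le_one]

theorem cutoff_eq_zero {k : ℕ} {x : ℝ} (hx : k + 1 ≤ |x|) : cutoff k x = 0 := by
  change max 0 (min 1 (k + 1 - |x|)) = 0
  rw [max_eq_left]
  exact (min_le_right _ _).trans (by linarith)

/-- The product of the cutoff with a continuous function. -/
def cutoffMul (k : ℕ) (g : C(ℝ, ℝ)) : C_c(ℝ, ℝ) where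
  toFun x := cutoff k x * g x
  continuous_toFun := by fun_prop
  hasCompactSupport' := (cutoff k).hasCompactSupport.mul_right

/-- Countably many test functions approximate every test function, uniformly and up to a
multiple of one of them. -/
theorem exists_countable_testFunctions : ∃ D : ℕ → C_c(ℝ, ℝ), ∀ φ : C_c(ℝ, ℝ), ∃ j,
    ∀ ε > 0, ∃ k, ∀ x, |φ x - D k x| ≤ ε * D j x := by
  obtain ⟨s, hs⟩ := TopologicalSpace.exists_dense_seq C(ℝ, ℝ)
  let D' : ℕ × Option ℕ → C_c(ℝ, ℝ) := fun p => match p.2 with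
    | none => cutoff p.1
    | some l => cutoffMul p.1 (s l)
  obtain ⟨e, he⟩ := exists_surjective_nat (ℕ × Option ℕ)
  refine ⟨fun n => D' (e n), fun φ => ?_⟩
  obtain ⟨R, hR⟩ := φ.hasCompactSupport.isCompact.isBounded.subset_closedBall 0
  obtain ⟨k, hk⟩ := exists_nat_ge R
  obtain ⟨j, hj⟩ := he (k, none)
  refine ⟨j, fun ε hε => ?_⟩
  have hφ0 : ∀ x : ℝ, k < |x| → φ x = 0 := fun x hx => by
    by_contra h
    have := hR (subset_tsupport _ h)
    rw [mem_closedBall_zero_iff, Real.norm_eq_abs] at this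
    linarith
  have hnhds : ∀ᶠ g in 𝓝 φ.toContinuousMap, ∀ x ∈ Set.Icc (-(k + 1 : ℝ)) (k + 1),
      dist (φ x) (g x) < ε :=
    Metric.tendstoUniformlyOn_iff.1
      (ContinuousMap.tendsto_iff_forall_isCompact_tendstoUniformlyOn.1
        (tendsto_id (x := 𝓝 φ.toContinuousMap)) _ isCompact_Icc) ε hε
  obtain ⟨_, hl, l, rfl⟩ := mem_closure_iff_nhds.1 (hs φ.toContinuousMap) _ hnhds
  obtain ⟨i, hi⟩ := he (k, some l)
  refine ⟨i, fun x => ?_⟩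
  simp only [hi, hj, D']
  change |φ x - cutoff k x * s l x| ≤ ε * cutoff k x
  by_cases hx : k + 1 ≤ |x|
  · rw [cutoff_eq_zero hx, hφ0 x (by linarith)]; simp
  · have h1 : φ x = cutoff k x * φ x := by
      by_cases hx' : |x| ≤ k
      · rw [cutoff_eq_one hx', one_mul]
      · rw [hφ0 x (not_le.1 hx'), mul_zero]
    rw [h1, ← mul_sub, abs_mul, abs_of_nonneg (cutoff_nonneg k x), mul_comm]
    refine mul_le_mul_of_nonneg_right ?_ (cutoff_nonneg k x)
    exact (hl x (abs_le.1 (not_le.1 hx).le)).le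

/-- A countable family of test functions that generates the vague topology. -/
def testFunction : ℕ → C_c(ℝ, ℝ) := exists_countable_testFunctions.choose

theorem testFunction_spec (φ : C_c(ℝ, ℝ)) : ∃ j, ∀ ε > 0, ∃ k, ∀ x,
    |φ x - testFunction k x| ≤ ε * testFunction j x :=
  exists_countable_testFunctions.choose_spec φ

namespace PointMeasure

instance (μ : PointMeasure) : IsLocallyFiniteMeasure μ.1 := μ.2.1

theorem integrable (μ : PointMeasure) (φ : C_c(ℝ, ℝ)) : Integrable φ μ.1 :=
  φ.continuous.integrable_of_hasCompactSupport φ.hasCompactSupport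

theorem continuous_integral (φ : C_c(ℝ, ℝ)) :
    Continuous fun μ : PointMeasure => ∫ x, φ x ∂μ.1 :=
  continuous_iInf_dom (i := φ) continuous_induced_dom

/-- The integrals of the countably many test functions. -/
def testIntegrals (μ : PointMeasure) (n : ℕ) : ℝ := ∫ x, testFunction n x ∂μ.1

theorem isInducing_testIntegrals : IsInducing testIntegrals := by
  have hc : Continuous testIntegrals := continuous_pi fun n => continuous_integral _
  refine isInducing_iff_nhds.2 fun μ => le_antisymm (hc.tendsto μ).le_comap ?_
  have hn : 𝓝 μ = ⨅ φ : C_c(ℝ, ℝ), comap (fun μ : PointMeasure => ∫ x, φ x ∂μ.1)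
      (𝓝 (∫ x, φ x ∂μ.1)) := by
    refine (nhds_iInf).trans ?_
    simp_rw [nhds_induced]
  rw [hn]
  refine le_iInf fun φ => tendsto_iff_comap.1 ?_
  have ht : ∀ n, Tendsto (fun ρ : PointMeasure => ∫ x, testFunction n x ∂ρ.1)
      (comap testIntegrals (𝓝 (testIntegrals μ))) (𝓝 (∫ x, testFunction n x ∂μ.1)) := fun n =>
    ((continuous_apply n).tendsto (testIntegrals μ)).comp (tendsto_comap (f := testIntegrals))
  obtain ⟨j, hj⟩ := testFunction_spec φ
  have hbound : ∀ ε > 0, ∀ k, (∀ x, |φ x - testFunction k x| ≤ ε * testFunction j x) →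
      ∀ ρ : PointMeasure, |(∫ x, φ x ∂ρ.1) - ∫ x, testFunction k x ∂ρ.1|
        ≤ ε * ∫ x, testFunction j x ∂ρ.1 := by
    intro ε hε k hk ρ
    rw [← integral_sub (ρ.integrable _) (ρ.integrable _), ← integral_const_mul]
    exact (abs_integral_le_integral_abs).trans (integral_mono
      ((ρ.integrable φ).sub (ρ.integrable _)).abs ((ρ.integrable _).const_mul _) hk)
  rw [Metric.tendsto_nhds]
  intro ε hε
  set c := |∫ x, testFunction j x ∂μ.1| + 1
  have hcpos : 0 < c := by positivity
  obtain ⟨k, hk⟩ := hj (ε / (4 * c)) (by positivity)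
  have hb := hbound _ (by positivity) k hk
  filter_upwards [Metric.tendsto_nhds.1 (ht k) (ε / 2) (by positivity),
    Metric.tendsto_nhds.1 (ht j) 1 one_pos] with ρ h1 h2
  have hle : ∀ y : ℝ, y ≤ c → ε / (4 * c) * y ≤ ε / 4 := fun y hy => by
    calc ε / (4 * c) * y ≤ ε / (4 * c) * c := by gcongr
      _ = ε / 4 := by field_simp
  have h3 := (hb ρ).trans (hle _ (by
    rw [Real.dist_eq] at h2
    linarith [(abs_lt.1 h2).2, le_abs_self (∫ x, testFunction j x ∂μ.1)]))
  have h4 := (hb μ).trans (hle _ (by linarith [le_abs_self (∫ x, testFunction j x ∂μ.1)]))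
  rw [Real.dist_eq] at h1 ⊢
  rw [abs_lt] at h1 ⊢
  rw [abs_le] at h3 h4
  constructor <;> linarith [h1.1, h1.2, h3.1, h3.2, h4.1, h4.2]

theorem measurable_iff {Ω : Type*} [MeasurableSpace Ω] {X : Ω → PointMeasure} :
    Measurable X ↔ ∀ φ : C_c(ℝ, ℝ), Measurable fun ω => ∫ x, φ x ∂(X ω).1 := by
  refine ⟨fun h φ => (continuous_integral φ).measurable.comp h, fun h => ?_⟩
  have hb : borel PointMeasure = (borel (ℕ → ℝ)).comap testIntegrals := by
    rw [← borel_comap, ← isInducing_testIntegrals.eq_induced]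
  change @Measurable _ _ _ (borel PointMeasure) X
  rw [hb, ← BorelSpace.measurable_eq (α := ℕ → ℝ)]
  exact measurable_comap_iff.2 (measurable_pi_iff.2 fun n => h _)

/-- The integrals of the first `k` test functions. -/
def testVector (k : ℕ) (μ : PointMeasure) : EuclideanSpace ℝ (Fin k) :=
  WithLp.toLp 2 fun i => testIntegrals μ i

theorem continuous_testVector (k : ℕ) : Continuous (testVector k) :=
  (PiLp.continuous_toLp 2 _).comp (continuous_pi fun _ => continuous_integral _)

theorem exists_monotone_isOpen_testVector {G : Set PointMeasure} (hG : IsOpen G) :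
    ∃ V : ∀ k : ℕ, Set (EuclideanSpace ℝ (Fin k)), (∀ k, IsOpen (V k)) ∧
      Monotone (fun k => testVector k ⁻¹' V k) ∧ ⋃ k, testVector k ⁻¹' V k = G := by
  let V : ∀ k : ℕ, Set (EuclideanSpace ℝ (Fin k)) := fun k =>
    ⋃₀ {O | IsOpen O ∧ testVector k ⁻¹' O ⊆ G}
  have hmem : ∀ k μ, testVector k μ ∈ V k ↔
      ∃ O, IsOpen O ∧ testVector k ⁻¹' O ⊆ G ∧ testVector k μ ∈ O := by
    intro k μ
    simp [V, and_assoc]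
  refine ⟨V, fun k => isOpen_sUnion fun O hO => hO.1, ?_, ?_⟩
  · intro k l hkl μ hμ
    obtain ⟨O, hO, hOG, hμO⟩ := (hmem k μ).1 hμ
    let r : EuclideanSpace ℝ (Fin l) → EuclideanSpace ℝ (Fin k) := fun y =>
      WithLp.toLp 2 fun i => y (Fin.castLE hkl i)
    have hr : Continuous r := by fun_prop
    have hrt : ∀ ρ, r (testVector l ρ) = testVector k ρ := fun ρ => rfl
    refine (hmem l μ).2 ⟨r ⁻¹' O, hO.preimage hr, fun ρ hρ => hOG ?_, ?_⟩
    · change testVector k ρ ∈ O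
      rw [← hrt]; exact hρ
    · change r (testVector l μ) ∈ O
      rw [hrt]; exact hμO
  · refine Set.Subset.antisymm (Set.iUnion_subset fun k μ hμ => ?_) fun μ hμ => ?_
    · obtain ⟨O, hO, hOG, hμO⟩ := (hmem k μ).1 hμ
      exact hOG hμO
    · obtain ⟨U, hU, rfl⟩ := isInducing_testIntegrals.isOpen_iff.1 hG
      obtain ⟨I, u, hIu, hsub⟩ := isOpen_pi_iff.1 hU _ hμ
      obtain ⟨k, hk⟩ := I.exists_nat_subset_range
      refine Set.mem_iUnion.2 ⟨k, (hmem k μ).2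
        ⟨⋂ i : {i : Fin k // (i : ℕ) ∈ I}, (fun y : EuclideanSpace ℝ (Fin k) => y i.1) ⁻¹' u i.1,
          isOpen_iInter_of_finite fun i => (hIu _ i.2).1.preimage (by fun_prop), ?_, ?_⟩⟩
      · intro ρ hρ
        refine hsub fun i hi => ?_
        exact Set.mem_iInter.1 hρ ⟨⟨i, Finset.mem_range.1 (hk hi)⟩, hi⟩
      · exact Set.mem_iInter.2 fun i => (hIu _ i.2).2

theorem charFun_map_testVector {Ω : Type*} [MeasurableSpace Ω] {P : Measure Ω}
    {X : Ω → PointMeasure} (hX : AEMeasurable X P) (k : ℕ) (t : EuclideanSpace ℝ (Fin k)) :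
    charFun (P.map fun ω => testVector k (X ω)) t = ∫ ω, Complex.exp
      ((∫ x, (∑ i : Fin k, t i • testFunction i) x ∂(X ω).1 : ℝ) * Complex.I) ∂P := by
  have hinner : ∀ μ : PointMeasure, inner ℝ (testVector k μ) t
      = ∫ x, (∑ i : Fin k, t i • testFunction i) x ∂μ.1 := by
    intro μ
    simp only [CompactlySupportedContinuousMap.sum_apply,
      CompactlySupportedContinuousMap.smul_apply, smul_eq_mul, PiLp.inner_apply]
    rw [integral_finsetSum _ fun i _ => (μ.integrable _).const_mul _]
    refine Finset.sum_congr rfl fun i _ => ?_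
    rw [integral_const_mul]
    rfl
  rw [charFun_apply]
  refine (integral_map ((continuous_testVector k).measurable.comp_aemeasurable hX)
    (by fun_prop)).trans ?_
  simp_rw [Function.comp_apply, hinner]

theorem map_testVector_apply {Ω : Type*} [MeasurableSpace Ω] {P : Measure Ω}
    {X : Ω → PointMeasure} (hX : AEMeasurable X P) {k : ℕ} {V : Set (EuclideanSpace ℝ (Fin k))}
    (hV : IsOpen V) :
    (P.map fun ω => testVector k (X ω)) V = P.map X (testVector k ⁻¹' V) := by
  have hm : Measurable (testVector k) := (continuous_testVector k).measurable
  rw [← Measure.map_apply hm hV.measurableSet,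
    AEMeasurable.map_map_of_aemeasurable hm.aemeasurable hX]
  rfl

/-- Convergence of the characteristic functionals implies convergence in law for the vague
topology. -/
theorem tendstoInDistribution_of_tendsto_charFunctional {Ω Ω' : Type*} [MeasurableSpace Ω]
    [MeasurableSpace Ω'] {P : Measure Ω} {P' : Measure Ω'} [IsProbabilityMeasure P]
    [IsProbabilityMeasure P'] {X : ℕ → Ω → PointMeasure} {Z : Ω' → PointMeasure}
    (hX : ∀ n, AEMeasurable (X n) P) (hZ : AEMeasurable Z P')
    (h : ∀ φ : C_c(ℝ, ℝ), Tendsto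
      (fun n => ∫ ω, Complex.exp ((∫ x, φ x ∂(X n ω).1 : ℝ) * Complex.I) ∂P) atTop
      (𝓝 (∫ ω, Complex.exp ((∫ x, φ x ∂(Z ω).1 : ℝ) * Complex.I) ∂P'))) :
    TendstoInDistribution X atTop Z (fun _ => P) P' := by
  refine ⟨hX, hZ, tendsto_of_forall_isOpen_le_liminf' fun G hG => ?_⟩
  have hm : ∀ k, Measurable (testVector k) := fun k => (continuous_testVector k).measurable
  have hfd : ∀ k, TendstoInDistribution (fun n ω => testVector k (X n ω)) atTop
      (fun ω => testVector k (Z ω)) (fun _ => P) P' := by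
    intro k
    refine ⟨fun n => (hm k).comp_aemeasurable (hX n), (hm k).comp_aemeasurable hZ,
      ProbabilityMeasure.tendsto_of_tendsto_charFun fun t => ?_⟩
    simp only [ProbabilityMeasure.coe_mk]
    rw [charFun_map_testVector hZ]
    simp_rw [fun n => charFun_map_testVector (hX n) k t]
    exact h _
  obtain ⟨V, hVo, hVm, rfl⟩ := exists_monotone_isOpen_testVector hG
  rw [hVm.measure_iUnion]
  refine iSup_le fun k => ?_
  have hk := ProbabilityMeasure.le_liminf_measure_open_of_tendsto (hfd k).tendsto (hVo k)
  simp only [ProbabilityMeasure.coe_mk] at hk ⊢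
  rw [map_testVector_apply hZ (hVo k)] at hk
  refine hk.trans (liminf_le_liminf (Eventually.of_forall fun n => ?_))
  rw [map_testVector_apply (hX n) (hVo k)]
  exact measure_mono (Set.subset_iUnion (fun k => testVector k ⁻¹' V k) k)

end PointMeasure

theorem isLocallyFiniteMeasure_iff_Icc {μ : Measure ℝ} :
    IsLocallyFiniteMeasure μ ↔ ∀ k : ℕ, μ (Set.Icc (-k : ℝ) k) < ∞ := by
  refine ⟨fun h k => isCompact_Icc.measure_lt_top, fun h => ⟨fun x => ?_⟩⟩
  obtain ⟨k, hk⟩ := exists_nat_gt |x|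
  exact ⟨_, Icc_mem_nhds (abs_lt.1 hk).1 (abs_lt.1 hk).2, h k⟩

theorem exists_eq_enat_sum_dirac {ι : Type*} (x : ι → ℝ) {B : Set ℝ} (hB : MeasurableSet B) :
    ∃ k : ℕ∞, Measure.sum (fun i => Measure.dirac (x i)) B = (k : ℝ≥0∞) := by
  refine ⟨{i | x i ∈ B}.encard, ?_⟩
  rw [Measure.sum_apply _ hB, ← ENNReal.tsum_set_one, tsum_subtype {i | x i ∈ B} (fun _ => 1)]
  refine tsum_congr fun i => ?_
  rw [Measure.dirac_apply' _ hB]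
  rfl

theorem toPointMeasure_val {μ : Measure ℝ} (h : IsPointMeasure μ) : (toPointMeasure μ).1 = μ := by
  simp [toPointMeasure, h]

theorem measurable_toPointMeasure {Ω : Type*} [MeasurableSpace Ω] {m : Ω → Measure ℝ}
    (hm : Measurable m)
    (hB : ∀ ω (B : Set ℝ), MeasurableSet B → ∃ k : ℕ∞, m ω B = (k : ℝ≥0∞)) :
    Measurable fun ω => toPointMeasure (m ω) := by
  have hms : MeasurableSet {ω | IsPointMeasure (m ω)} := by
    have : {ω | IsPointMeasure (m ω)} = ⋂ k : ℕ, {ω | m ω (Set.Icc (-k : ℝ) k) < ∞} := by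
      ext ω
      simp only [Set.mem_ofPred_eq, Set.mem_iInter]
      rw [← isLocallyFiniteMeasure_iff_Icc]
      exact ⟨fun h => h.1, fun h => ⟨h, hB ω⟩⟩
    rw [this]
    exact MeasurableSet.iInter fun k => measurableSet_lt
      ((Measure.measurable_coe measurableSet_Icc).comp hm) measurable_const
  rw [PointMeasure.measurable_iff]
  intro φ
  have h1 : (fun ω => ∫ x, φ x ∂(toPointMeasure (m ω)).1)
      = {ω | IsPointMeasure (m ω)}.indicator fun ω => (∫⁻ x, ENNReal.ofReal (φ x) ∂(m ω)).toReal
        - (∫⁻ x, ENNReal.ofReal (-φ x) ∂(m ω)).toReal := by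
    ext ω
    by_cases h : IsPointMeasure (m ω)
    · rw [Set.indicator_of_mem (show ω ∈ {ω | IsPointMeasure (m ω)} from h), toPointMeasure_val h]
      exact integral_eq_lintegral_pos_part_sub_lintegral_neg_part
        (PointMeasure.integrable ⟨m ω, h⟩ φ)
    · rw [Set.indicator_of_notMem (show ω ∉ {ω | IsPointMeasure (m ω)} from h)]
      simp [toPointMeasure, h]
  rw [h1]
  have hφ := φ.continuous.measurable
  exact Measurable.indicator
    (((Measure.measurable_lintegral hφ.ennreal_ofReal).comp hm).ennreal_toReal.sub
    ((Measure.measurable_lintegral hφ.neg.ennreal_ofReal).comp hm).ennreal_toReal) hms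

end

section

/-! ### Sums of point masses -/

/-- The sum of the point masses at `x i`, over `i ∈ s`. -/
def pointSum {ι : Type*} (s : Set ι) (x : ι → ℝ) : Measure ℝ :=
  Measure.sum fun i : s => Measure.dirac (x i)

section pointSum

variable {ι : Type*} (s : Set ι) (x : ι → ℝ)

theorem pointSum_apply {B : Set ℝ} (hB : MeasurableSet B) :
    pointSum s x B = ∑' i, s.indicator (fun i => B.indicator 1 (x i)) i := by
  rw [pointSum, Measure.sum_apply _ hB, ← tsum_subtype]
  exact tsum_congr fun i => Measure.dirac_apply' _ hB

theorem map_pointSum {g : ℝ → ℝ} (hg : Measurable g) :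
    (pointSum s x).map g = pointSum s (fun i => g (x i)) := by
  rw [pointSum, Measure.map_sum hg.aemeasurable]
  simp_rw [Measure.map_dirac' hg]
  rfl

theorem isPointMeasure_pointSum_iff :
    IsPointMeasure (pointSum s x) ↔ IsLocallyFiniteMeasure (pointSum s x) :=
  ⟨fun h => h.1, fun h => ⟨h, fun _ hB => exists_eq_enat_sum_dirac _ hB⟩⟩

theorem hasSum_integral_pointSum {f : ℝ → ℝ} (hf : Measurable f)
    (hi : Integrable f (pointSum s x)) :
    HasSum (fun i => s.indicator (fun i => f (x i)) i) (∫ y, f y ∂(pointSum s x)) := by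
  have := hasSum_integral_measure hi
  simp_rw [integral_dirac' f _ hf.stronglyMeasurable] at this
  exact hasSum_subtype_iff_indicator.1 this

theorem measurable_pointSum {Ω : Type*} [MeasurableSpace Ω] [Countable ι] {s : Ω → Set ι}
    {x : ι → Ω → ℝ} (hs : ∀ i, MeasurableSet {ω | i ∈ s ω}) (hx : ∀ i, Measurable (x i)) :
    Measurable fun ω => pointSum (s ω) (fun i => x i ω) := by
  refine Measure.measurable_of_measurable_coe _ fun B hB => ?_
  simp_rw [pointSum_apply _ _ hB]
  refine Measurable.tsum fun i => ?_
  exact Measurable.indicator ((measurable_one.indicator hB).comp (hx i)) (hs i)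

theorem measurable_toPointMeasure_pointSum {Ω : Type*} [MeasurableSpace Ω] [Countable ι]
    {s : Ω → Set ι} {x : ι → Ω → ℝ} (hs : ∀ i, MeasurableSet {ω | i ∈ s ω})
    (hx : ∀ i, Measurable (x i)) :
    Measurable fun ω => toPointMeasure (pointSum (s ω) fun i => x i ω) :=
  measurable_toPointMeasure (measurable_pointSum hs hx) fun _ _ hB => exists_eq_enat_sum_dirac _ hB

end pointSum

theorem integral_infinitePi_prod {ι : Type*} {X : ι → Type*} [∀ i, MeasurableSpace (X i)]
    (μ : ∀ i, Measure (X i)) [∀ i, IsProbabilityMeasure (μ i)] (s : Finset ι)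
    {f : ∀ i, X i → ℂ} (hf : ∀ i, Measurable (f i)) :
    ∫ ω, ∏ i ∈ s, f i (ω i) ∂(Measure.infinitePi μ) = ∏ i ∈ s, ∫ y, f i y ∂(μ i) := by
  have h := integral_restrict_infinitePi (μ := μ) (s := s)
    (f := fun y : (∀ i : s, X i) => ∏ i : s, f i (y i))
    (Measurable.aestronglyMeasurable
      (Finset.measurable_prod _ fun i _ => (hf i).comp (measurable_pi_apply i)))
  rw [integral_fintype_prod_eq_prod (fun (i : s) y => f i y)] at h
  rw [← Finset.prod_coe_sort, ← h]
  refine integral_congr_ae (ae_of_all _ fun ω => ?_)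
  exact (Finset.prod_coe_sort s fun i => f i (ω i)).symm

/-! ### Poisson processes -/

/-- `Z` is a Poisson point process with intensity measure `μ`, in terms of its characteristic
functional. -/
def IsPoissonProcess {Ω : Type*} [MeasurableSpace Ω] (P : Measure Ω) (μ : Measure ℝ)
    (Z : Ω → Measure ℝ) : Prop :=
  ∀ f : ℝ → ℝ, Measurable f → (∃ C, ∀ x, |f x| ≤ C) → (∃ R, ∀ x, R < |x| → f x = 0) →
    ∫ ω, Complex.exp ((∫ x, f x ∂(Z ω) : ℝ) * Complex.I) ∂P
      = Complex.exp (∫ x, (Complex.exp (f x * Complex.I) - 1) ∂μ)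

theorem integral_pow_poissonMeasure (r : ℝ≥0) (c : ℂ) :
    ∫ n, c ^ n ∂(poissonMeasure r) = Complex.exp (r * (c - 1)) := by
  rw [integral_poissonMeasure]
  have h := (NormedSpace.expSeries_div_hasSum_exp ((r : ℂ) * c)).mul_left (Complex.exp (-r))
  rw [← Complex.exp_eq_exp_ℂ, ← Complex.exp_add] at h
  rw [show (r : ℂ) * (c - 1) = -r + r * c by ring, ← h.tsum_eq]
  refine tsum_congr fun n => ?_
  rw [Complex.real_smul]
  push_cast
  ring

/-- The samples of a Poisson process: for every cell `[j, j + 1)`, a number of points and a sequence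
of positions. -/
abbrev CellSample : Type := ℤ → ℕ × (ℕ → ℝ)

/-- The law of the samples, for given mean numbers of points and given laws of the positions. -/
def cellLaw (r : ℤ → ℝ≥0) (ρ : ℤ → Measure ℝ) [∀ j, IsProbabilityMeasure (ρ j)] :
    Measure CellSample :=
  Measure.infinitePi fun j => (poissonMeasure (r j)).prod (Measure.infinitePi fun _ => ρ j)

instance (r : ℤ → ℝ≥0) (ρ : ℤ → Measure ℝ) [∀ j, IsProbabilityMeasure (ρ j)] :
    IsProbabilityMeasure (cellLaw r ρ) := by
  unfold cellLaw; infer_instance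

/-- The cell `[j, j + 1)`. -/
def cell (j : ℤ) : Set ℝ := Set.Ico (j : ℝ) (j + 1)

theorem measurableSet_cell (j : ℤ) : MeasurableSet (cell j) := measurableSet_Ico

/-- The labels of the points of a sample. -/
def cellPoints (ω : CellSample) : Set ((_ : ℤ) × ℕ) :=
  {p | p.2 < (ω p.1).1 ∧ (ω p.1).2 p.2 ∈ cell p.1}

/-- The position of a point of a sample. -/
def cellPosition (p : (_ : ℤ) × ℕ) (ω : CellSample) : ℝ := (ω p.1).2 p.2

theorem measurable_cellPosition (p : (_ : ℤ) × ℕ) : Measurable (cellPosition p) :=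
  (measurable_pi_apply p.2).comp (measurable_snd.comp (measurable_pi_apply p.1))

theorem measurableSet_mem_cellPoints (p : (_ : ℤ) × ℕ) :
    MeasurableSet {ω | p ∈ cellPoints ω} := by
  refine MeasurableSet.inter ?_ ((measurableSet_cell p.1).preimage (measurable_cellPosition p))
  exact (MeasurableSet.of_discrete (s := {n : ℕ | p.2 < n})).preimage
    (measurable_fst.comp (measurable_pi_apply p.1))

/-- For functions that vanish outside finitely many cells, sums over the points of a sample are
finite sums. -/
theorem finite_support_cellPoints (ω : CellSample) (R : ℝ) :
    {p ∈ cellPoints ω | |cellPosition p ω| ≤ R}.Finite := by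
  refine ((Finset.Icc (-⌈R⌉ - 1) ⌈R⌉).sigma fun j => Finset.range (ω j).1).finite_toSet.subset ?_
  rintro ⟨j, l⟩ ⟨⟨h1, h2⟩, h3⟩
  simp only [cellPosition] at h1 h2 h3
  simp only [Finset.coe_sigma, Set.mem_sigma_iff, Finset.coe_Icc, Set.mem_Icc, Finset.coe_range,
    Set.mem_Iio]
  have h4 := abs_le.1 h3
  have h5 := Int.le_ceil R
  refine ⟨⟨?_, ?_⟩, h1⟩
  · have : ((-⌈R⌉ - 1 : ℤ) : ℝ) ≤ j := by push_cast; linarith [h2.2]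
    exact_mod_cast this
  · have : (j : ℝ) ≤ ⌈R⌉ := by linarith [h2.1]
    exact_mod_cast this

theorem isLocallyFiniteMeasure_pointSum_of_finite {ι : Type*} {s : Set ι} {x : ι → ℝ}
    (h : ∀ R : ℝ, {p ∈ s | |x p| ≤ R}.Finite) : IsLocallyFiniteMeasure (pointSum s x) := by
  rw [isLocallyFiniteMeasure_iff_Icc]
  intro k
  rw [pointSum_apply _ _ measurableSet_Icc, tsum_eq_sum (s := (h k).toFinset)]
  · exact ENNReal.sum_lt_top.2 fun i _ => (Set.indicator_le_self' (fun _ _ => zero_le) _).trans_lt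
      ((Set.indicator_le_self' (fun _ _ => zero_le) _).trans_lt ENNReal.one_lt_top)
  · intro i hi
    simp only [Set.Finite.mem_toFinset, Set.mem_ofPred_eq, not_and] at hi
    by_cases his : i ∈ s
    · rw [Set.indicator_of_mem his, Set.indicator_of_notMem]
      exact fun hx => hi his (abs_le.2 hx)
    · rw [Set.indicator_of_notMem his]

theorem integral_pointSum_eq_sum {ι : Type*} {s : Set ι} {x : ι → ℝ}
    (h : ∀ R : ℝ, {p ∈ s | |x p| ≤ R}.Finite) {f : ℝ → ℝ} (hf : Measurable f) {C R : ℝ}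
    (hC : ∀ x, |f x| ≤ C) (hR : ∀ x, R < |x| → f x = 0) (F : Finset ι)
    (hF : ∀ p ∈ s, |x p| ≤ R → p ∈ F) :
    ∫ y, f y ∂(pointSum s x) = ∑ i ∈ F, s.indicator (fun i => f (x i)) i := by
  have := isLocallyFiniteMeasure_pointSum_of_finite h
  have hi : Integrable f (pointSum s x) := by
    have hb : IntegrableOn f (Set.Icc (-R) R) (pointSum s x) :=
      Measure.integrableOn_of_bounded (isCompact_Icc.measure_lt_top).ne hf.aestronglyMeasurable
        (ae_of_all _ fun x => hC x)
    refine (integrableOn_iff_integrable_of_support_subset fun y hy => ?_).1 hb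
    by_contra hy'
    exact hy (hR y (not_le.1 fun h => hy' (abs_le.1 h)))
  refine (hasSum_integral_pointSum s x hf hi).unique (hasSum_sum_of_ne_finset_zero fun i hi => ?_)
  by_cases his : i ∈ s
  · rw [Set.indicator_of_mem his]
    exact hR _ (not_le.1 fun h => hi (hF i his h))
  · rw [Set.indicator_of_notMem his]

end

section

theorem norm_exp_mul_I_sub_one_le (x : ℝ) : ‖Complex.exp (x * Complex.I) - 1‖ ≤ 2 := by
  refine (norm_sub_le _ _).trans ?_
  rw [Complex.norm_exp_ofReal_mul_I, norm_one]
  norm_num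

theorem measurable_prod_range_exp {g : ℝ → ℝ} (hg : Measurable g) :
    Measurable fun y : ℕ × (ℕ → ℝ) =>
      ∏ l ∈ Finset.range y.1, Complex.exp (g (y.2 l) * Complex.I) := by
  refine measurable_from_prod_countable_right fun n => ?_
  change Measurable fun y : ℕ → ℝ => ∏ l ∈ Finset.range n, Complex.exp (g (y l) * Complex.I)
  exact Finset.measurable_fun_prod _ fun l _ => by fun_prop

theorem integral_exp_sum_prod_poissonMeasure (r : ℝ≥0) (ρ : Measure ℝ) [IsProbabilityMeasure ρ]
    {g : ℝ → ℝ} (hg : Measurable g) :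
    ∫ y, ∏ l ∈ Finset.range y.1, Complex.exp (g (y.2 l) * Complex.I)
        ∂((poissonMeasure r).prod (Measure.infinitePi fun _ : ℕ => ρ))
      = Complex.exp (r * ∫ x, (Complex.exp (g x * Complex.I) - 1) ∂ρ) := by
  have hms := measurable_prod_range_exp hg
  have hint : Integrable (fun x => Complex.exp (g x * Complex.I)) ρ :=
    (integrable_const (1 : ℝ)).mono' (by fun_prop)
      (ae_of_all _ fun x => (Complex.norm_exp_ofReal_mul_I _).le)
  rw [integral_prod]
  · simp_rw [integral_infinitePi_prod (fun _ : ℕ => ρ) _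
      (f := fun _ x => Complex.exp (g x * Complex.I)) (fun _ => by fun_prop), Finset.prod_const,
      Finset.card_range]
    rw [integral_pow_poissonMeasure, integral_sub hint (integrable_const _)]
    simp
  · refine (integrable_const (1 : ℝ)).mono' hms.aestronglyMeasurable (ae_of_all _ fun y => ?_)
    rw [norm_prod]
    exact (Finset.prod_eq_one fun l _ => Complex.norm_exp_ofReal_mul_I _).le

/-- The points sampled cell by cell form a Poisson process. -/
theorem isPoissonProcess_cellLaw {μ : Measure ℝ} [IsLocallyFiniteMeasure μ] (r : ℤ → ℝ≥0)
    (ρ : ℤ → Measure ℝ) [∀ j, IsProbabilityMeasure (ρ j)]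
    (h : ∀ j, μ.restrict (cell j) = r j • ρ j) :
    IsPoissonProcess (cellLaw r ρ) μ
      (fun ω => pointSum (cellPoints ω) fun p => cellPosition p ω) := by
  rintro f hf ⟨C, hC⟩ ⟨R, hR⟩
  set J := Finset.Icc (-⌈R⌉ - 1) ⌈R⌉
  have hJ : ∀ x : ℝ, |x| ≤ R → ∀ j, x ∈ cell j → j ∈ J := by
    intro x hx j hj
    have h4 := abs_le.1 hx
    have h5 := Int.le_ceil R
    have h6 : ((-⌈R⌉ - 1 : ℤ) : ℝ) ≤ j := by push_cast; linarith [hj.2]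
    have h7 : (j : ℝ) ≤ ⌈R⌉ := by linarith [hj.1]
    exact Finset.mem_Icc.2 ⟨by exact_mod_cast h6, by exact_mod_cast h7⟩
  have hg : ∀ j, Measurable ((cell j).indicator f) := fun j => hf.indicator (measurableSet_cell j)
  have h1 : ∀ ω : CellSample,
      Complex.exp ((∫ x, f x ∂(pointSum (cellPoints ω) fun p => cellPosition p ω) : ℝ) * Complex.I)
      = ∏ j ∈ J, ∏ l ∈ Finset.range (ω j).1,
        Complex.exp ((cell j).indicator f ((ω j).2 l) * Complex.I) := by
    intro ω
    rw [integral_pointSum_eq_sum (finite_support_cellPoints ω) hf hC hR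
      (J.sigma fun j => Finset.range (ω j).1)
      (fun p hp hpR => Finset.mem_sigma.2 ⟨hJ _ hpR _ hp.2, Finset.mem_range.2 hp.1⟩),
      Finset.sum_sigma]
    push_cast
    rw [Finset.sum_mul, Complex.exp_sum]
    refine Finset.prod_congr rfl fun j _ => ?_
    rw [Finset.sum_mul, Complex.exp_sum]
    refine Finset.prod_congr rfl fun l hl => ?_
    congr 3
    by_cases hx : (ω j).2 l ∈ cell j
    · rw [Set.indicator_of_mem hx, Set.indicator_of_mem (show (⟨j, l⟩ : (_ : ℤ) × ℕ) ∈ cellPoints ω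
        from ⟨Finset.mem_range.1 hl, hx⟩)]
      rfl
    · rw [Set.indicator_of_notMem hx, Set.indicator_of_notMem fun h' => hx h'.2]
  simp_rw [h1]
  rw [cellLaw, integral_infinitePi_prod (fun j => (poissonMeasure (r j)).prod _) J
    (f := fun j (y : ℕ × (ℕ → ℝ)) => ∏ l ∈ Finset.range y.1,
      Complex.exp ((cell j).indicator f (y.2 l) * Complex.I))
    (fun j => measurable_prod_range_exp (hg j))]
  simp_rw [fun j => integral_exp_sum_prod_poissonMeasure (r j) (ρ j) (hg j)]
  rw [← Complex.exp_sum]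
  congr 1
  have h2 : ∀ j, (r j : ℂ) * ∫ x, (Complex.exp ((cell j).indicator f x * Complex.I) - 1) ∂(ρ j)
      = ∫ x in cell j, (Complex.exp (f x * Complex.I) - 1) ∂μ := by
    intro j
    calc (r j : ℂ) * ∫ x, (Complex.exp ((cell j).indicator f x * Complex.I) - 1) ∂(ρ j)
        = ∫ x in cell j, (Complex.exp ((cell j).indicator f x * Complex.I) - 1) ∂μ := by
          rw [h, integral_smul_nnreal_measure]
          rfl
      _ = _ := by
          refine setIntegral_congr_fun (measurableSet_cell j) fun x hx => ?_
          simp only [Set.indicator_of_mem hx]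
  simp_rw [h2]
  have hdisj : Set.Pairwise (↑J : Set ℤ) (Function.onFun Disjoint cell) := by
    intro i _ j _ hij
    refine Set.disjoint_left.2 fun x hi hj => hij ?_
    rw [← Int.floor_eq_iff.2 ⟨hi.1, hi.2⟩, ← Int.floor_eq_iff.2 ⟨hj.1, hj.2⟩]
  rw [← integral_biUnion_finset J (fun j _ => measurableSet_cell j) hdisj]
  · refine setIntegral_eq_integral_of_forall_compl_eq_zero fun x hx => ?_
    have : f x = 0 := by
      refine hR x (not_le.1 fun hxR => hx ?_)
      refine Set.mem_biUnion (hJ x hxR ⌊x⌋ ?_) ?_ <;>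
      exact ⟨Int.floor_le x, Int.lt_floor_add_one x⟩
    simp [this]
  · intro j _
    refine Measure.integrableOn_of_bounded (M := 2) ?_ (by fun_prop)
      (ae_of_all _ fun x => norm_exp_mul_I_sub_one_le _)
    exact ((measure_mono Set.Ico_subset_Icc_self).trans_lt isCompact_Icc.measure_lt_top).ne

theorem exists_cellLaw (μ : Measure ℝ) [IsLocallyFiniteMeasure μ] :
    ∃ (r : ℤ → ℝ≥0) (ρ : ℤ → Measure ℝ), (∀ j, IsProbabilityMeasure (ρ j)) ∧
      ∀ j, μ.restrict (cell j) = r j • ρ j := by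
  have h : ∀ j : ℤ, ∃ (r : ℝ≥0) (ρ : Measure ℝ), IsProbabilityMeasure ρ ∧
      μ.restrict (cell j) = r • ρ := by
    intro j
    have hfin : μ (cell j) ≠ ∞ :=
      ((measure_mono Set.Ico_subset_Icc_self).trans_lt isCompact_Icc.measure_lt_top).ne
    by_cases h0 : μ (cell j) = 0
    · exact ⟨0, Measure.dirac 0, inferInstance, by rw [Measure.restrict_eq_zero.2 h0, zero_smul]⟩
    · refine ⟨(μ (cell j)).toNNReal, (μ (cell j))⁻¹ • μ.restrict (cell j), ⟨?_⟩, ?_⟩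
      · rw [Measure.smul_apply, Measure.restrict_apply_univ, smul_eq_mul,
          ENNReal.inv_mul_cancel h0 hfin]
      · rw [← Measure.coe_nnreal_smul, ENNReal.coe_toNNReal hfin, smul_smul,
          ENNReal.mul_inv_cancel h0 hfin, one_smul]
  choose r ρ hρ using h
  exact ⟨r, ρ, fun j => (hρ j).1, fun j => (hρ j).2⟩

theorem integral_exp_sum_indicator_sub_one {μ : Measure ℝ} [IsLocallyFiniteMeasure μ] {k : ℕ}
    {B : Fin k → Set ℝ} (hB : ∀ i, MeasurableSet (B i))
    (hb : ∀ i, Bornology.IsBounded (B i)) (hd : ∀ i j, i ≠ j → Disjoint (B i) (B j))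
    (t : Fin k → ℝ) :
    ∫ x, (Complex.exp ((∑ i, (B i).indicator (fun _ => t i) x : ℝ) * Complex.I) - 1) ∂μ
      = ∑ i, μ.real (B i) * (Complex.exp (t i * Complex.I) - 1) := by
  have h1 : ∀ x, Complex.exp ((∑ i, (B i).indicator (fun _ => t i) x : ℝ) * Complex.I) - 1
      = ∑ i, (B i).indicator (fun _ => Complex.exp (t i * Complex.I) - 1) x := by
    intro x
    by_cases hx : ∃ i, x ∈ B i
    · obtain ⟨i, hi⟩ := hx
      have hj : ∀ j ≠ i, x ∉ B j := fun j hj hxj => Set.disjoint_left.1 (hd j i hj) hxj hi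
      rw [Finset.sum_eq_single i (fun j _ h => Set.indicator_of_notMem (hj j h) _) (by simp),
        Finset.sum_eq_single i (fun j _ h => Set.indicator_of_notMem (hj j h) _) (by simp),
        Set.indicator_of_mem hi, Set.indicator_of_mem hi]
    · push Not at hx
      rw [Finset.sum_eq_zero fun i _ => Set.indicator_of_notMem (hx i) _,
        Finset.sum_eq_zero fun i _ => Set.indicator_of_notMem (hx i) _]
      simp
  simp_rw [h1]
  rw [integral_finsetSum]
  · refine Finset.sum_congr rfl fun i _ => ?_
    rw [integral_indicator_const _ (hB i), Complex.real_smul]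
  · intro i _
    exact (integrable_indicator_iff (hB i)).2 (integrableOn_const (hb i).measure_lt_top.ne)

theorem IsPoissonProcess.measure_counts {Ω : Type*} [MeasurableSpace Ω] {P : Measure Ω}
    [IsProbabilityMeasure P] {μ : Measure ℝ} [IsLocallyFiniteMeasure μ] {Z : Ω → Measure ℝ}
    (hZ : IsPoissonProcess P μ Z) (hm : Measurable Z) (hloc : ∀ ω, IsLocallyFiniteMeasure (Z ω))
    {k : ℕ} {B : Fin k → Set ℝ} (hB : ∀ i, MeasurableSet (B i))
    (hb : ∀ i, Bornology.IsBounded (B i)) (hd : ∀ i j, i ≠ j → Disjoint (B i) (B j))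
    (c : Fin k → ℕ) :
    P {ω | ∀ i, Z ω (B i) = (c i : ℝ≥0∞)}
      = ∏ i, poissonMeasure (μ (B i)).toNNReal {c i} := by
  let X : Ω → Fin k → ℝ := fun ω i => (Z ω).real (B i)
  have hX : Measurable X := measurable_pi_iff.2 fun i =>
    ((Measure.measurable_coe (hB i)).comp hm).ennreal_toReal
  have hlaw : P.map X = Measure.pi fun i =>
      (poissonMeasure (μ (B i)).toNNReal).map (Nat.cast : ℕ → ℝ) := by
    have : IsProbabilityMeasure (P.map X) := Measure.isProbabilityMeasure_map hX.aemeasurable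
    refine charFun_eq_pi_iff.1 fun t => ?_
    let f : ℝ → ℝ := fun x => ∑ i, (B i).indicator (fun _ => t i) x
    have hf : Measurable f := Finset.measurable_fun_sum _ fun i _ =>
      measurable_const.indicator (hB i)
    obtain ⟨R, hR⟩ := ((Bornology.isBounded_iUnion).2 hb).subset_closedBall 0
    have hZf := hZ f hf ⟨∑ i, |t i|, fun x => (Finset.abs_sum_le_sum_abs _ _).trans
      (Finset.sum_le_sum fun i _ => by
        by_cases hx : x ∈ B i
        · rw [Set.indicator_of_mem hx]
        · rw [Set.indicator_of_notMem hx, abs_zero]; positivity)⟩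
      ⟨R, fun x hx => Finset.sum_eq_zero fun i _ => Set.indicator_of_notMem (fun hxi => by
        have := hR (Set.mem_iUnion.2 ⟨i, hxi⟩)
        rw [mem_closedBall_zero_iff, Real.norm_eq_abs] at this
        linarith) _⟩
    have hint : ∀ ω, ∫ x, f x ∂(Z ω) = ∑ i, X ω i * t i := by
      intro ω
      have := hloc ω
      rw [integral_finsetSum]
      · refine Finset.sum_congr rfl fun i _ => ?_
        rw [integral_indicator_const _ (hB i), smul_eq_mul]
      · intro i _
        exact (integrable_indicator_iff (hB i)).2 (integrableOn_const (hb i).measure_lt_top.ne)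
    rw [charFun_apply, integral_map (by fun_prop) (by fun_prop),
      integral_map hX.aemeasurable (by fun_prop)]
    simp_rw [charFun_map_cast_poissonMeasure]
    rw [← Complex.exp_sum]
    refine Eq.trans ?_ (hZf.trans ?_)
    · refine integral_congr_ae (ae_of_all _ fun ω => ?_)
      simp only [hint, PiLp.inner_apply, Real.inner_apply]
    · rw [integral_exp_sum_indicator_sub_one hB hb hd]
      rfl
  have hset : {ω | ∀ i, Z ω (B i) = (c i : ℝ≥0∞)}
      = X ⁻¹' (Set.univ.pi fun i => {(c i : ℝ)}) := by
    ext ω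
    have := hloc ω
    simp only [Set.mem_ofPred_eq, Set.mem_preimage, Set.mem_pi, Set.mem_univ, true_implies,
      Set.mem_singleton_iff, X]
    refine forall_congr' fun i => ?_
    rw [measureReal_def, ← ENNReal.toReal_natCast,
      ENNReal.toReal_eq_toReal_iff' (hb i).measure_lt_top.ne
      (ENNReal.natCast_ne_top _)]
  rw [hset, ← Measure.map_apply hX (MeasurableSet.univ_pi fun i => measurableSet_singleton _), hlaw,
    Measure.pi_pi]
  refine Finset.prod_congr rfl fun i _ => ?_
  rw [Measure.map_apply .of_discrete (measurableSet_singleton _)]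
  congr 1
  ext n
  simp

end

section

/-! ### Cox processes with exponential intensity -/

theorem map_add_expIntensity (θ s : ℝ) :
    (expIntensity θ).map (fun x => x + s)
      = ENNReal.ofReal (Real.exp (θ * s)) • expIntensity θ := by
  ext B hB
  have hm : Measurable fun x : ℝ => x + s := by fun_prop
  have hd : Measurable fun x : ℝ => ENNReal.ofReal (θ * Real.exp (-θ * x)) := by fun_prop
  rw [Measure.map_apply hm hB, expIntensity, withDensity_apply _ (hB.preimage hm),
    Measure.smul_apply, withDensity_apply _ hB, smul_eq_mul, ← lintegral_const_mul _ hd,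
    ← lintegral_indicator (hB.preimage hm), ← lintegral_indicator hB,
    ← lintegral_add_right_eq_self (B.indicator fun x =>
      ENNReal.ofReal (Real.exp (θ * s)) * ENNReal.ofReal (θ * Real.exp (-θ * x))) s]
  refine lintegral_congr fun x => ?_
  by_cases hx : x + s ∈ B
  · rw [Set.indicator_of_mem hx, Set.indicator_of_mem (show x ∈ (fun x => x + s) ⁻¹' B from hx),
      ← ENNReal.ofReal_mul (Real.exp_pos _).le]
    congr 1
    rw [mul_left_comm, ← Real.exp_add]
    congr 2
    ring
  · rw [Set.indicator_of_notMem hx, Set.indicator_of_notMem]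
    exact hx

instance (θ : ℝ) : IsLocallyFiniteMeasure (expIntensity θ) := by
  rw [isLocallyFiniteMeasure_iff_Icc]
  intro k
  rw [expIntensity, withDensity_apply _ measurableSet_Icc]
  have : IntegrableOn (fun x => θ * Real.exp (-θ * x)) (Set.Icc (-k : ℝ) k) :=
    (by fun_prop : Continuous fun x => θ * Real.exp (-θ * x)).continuousOn.integrableOn_Icc
  exact this.lintegral_lt_top

/-- The points of the Cox process with intensity `q * θ exp (-θ x) dx`: the points of the process
for `q = 1`, shifted by `log q / θ`. -/
def coxMeasure (θ : ℝ) (p : ℝ≥0 × CellSample) : Measure ℝ :=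
  pointSum {i | i ∈ cellPoints p.2 ∧ p.1 ≠ 0} fun i => cellPosition i p.2 + Real.log p.1 / θ

theorem measurable_coxMeasure (θ : ℝ) : Measurable (coxMeasure θ) :=
  measurable_pointSum (s := fun p : ℝ≥0 × CellSample => {i | i ∈ cellPoints p.2 ∧ p.1 ≠ 0})
    (fun i => ((measurableSet_mem_cellPoints i).preimage measurable_snd).inter
      ((measurableSet_singleton (0 : ℝ≥0)).compl.preimage measurable_fst))
    (fun i => ((measurable_cellPosition i).comp measurable_snd).add
      ((Real.measurable_log.comp (measurable_fst.coe_nnreal_real)).div_const θ))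

theorem isPointMeasure_coxMeasure (θ : ℝ) (p : ℝ≥0 × CellSample) :
    IsPointMeasure (coxMeasure θ p) := by
  rw [coxMeasure, isPointMeasure_pointSum_iff]
  refine isLocallyFiniteMeasure_pointSum_of_finite fun R => ?_
  refine (finite_support_cellPoints p.2 (R + |Real.log p.1 / θ|)).subset fun i hi => ⟨hi.1.1, ?_⟩
  have h1 := abs_sub (cellPosition i p.2 + Real.log p.1 / θ) (Real.log p.1 / θ)
  rw [add_sub_cancel_right] at h1
  linarith [hi.2]

theorem isPoissonProcess_coxMeasure {θ : ℝ} (hθ : θ ≠ 0) {P : Measure CellSample}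
    [IsProbabilityMeasure P]
    (h : IsPoissonProcess P (expIntensity θ)
      (fun ω => pointSum (cellPoints ω) fun i => cellPosition i ω)) (q : ℝ≥0) :
    IsPoissonProcess P (q • expIntensity θ) (fun ω => coxMeasure θ (q, ω)) := by
  rintro f hf ⟨C, hC⟩ ⟨R, hR⟩
  by_cases hq : q = 0
  · subst hq
    simp [coxMeasure, pointSum]
  · set s := Real.log q / θ
    have hm : Measurable fun x : ℝ => x + s := by fun_prop
    have h1 : ∀ ω, coxMeasure θ (q, ω)
        = (pointSum (cellPoints ω) fun i => cellPosition i ω).map (fun x => x + s) := by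
      intro ω
      rw [map_pointSum _ _ hm, coxMeasure]
      simp only [ne_eq, hq, not_false_eq_true, and_true]
      rfl
    have h2 := h (fun x => f (x + s)) (hf.comp hm) ⟨C, fun x => hC _⟩ ⟨R + |s|, fun x hx => hR _ (by
      have h3 := abs_sub (x + s) s
      rw [add_sub_cancel_right] at h3
      linarith)⟩
    simp_rw [h1]
    simp_rw [integral_map hm.aemeasurable hf.aestronglyMeasurable]
    rw [h2]
    have h4 : q • expIntensity θ = (expIntensity θ).map fun x => x + s := by
      rw [map_add_expIntensity, mul_div_cancel₀ _ hθ, Real.exp_log (by positivity),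
        ENNReal.ofReal_coe_nnreal, Measure.coe_nnreal_smul]
    rw [h4, integral_map hm.aemeasurable (by fun_prop)]

/-- A Cox process exists, for every law of the random intensity. -/
theorem exists_isCoxProcess {θ : ℝ} (hθ : θ ≠ 0) (ρ : Measure ℝ≥0) [IsProbabilityMeasure ρ] :
    ∃ (Ω' : Type) (_ : MeasurableSpace Ω') (P' : Measure Ω') (_ : IsProbabilityMeasure P')
      (Q : Ω' → ℝ≥0) (Z : Ω' → PointMeasure),
      P'.map Q = ρ ∧ IsCoxProcess P' Q (expIntensity θ) Z ∧
      ∀ φ : C_c(ℝ, ℝ), ∫ ω, Complex.exp ((∫ x, φ x ∂(Z ω).1 : ℝ) * Complex.I) ∂P'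
        = ∫ q : ℝ≥0, Complex.exp (q * ∫ x, (Complex.exp (φ x * Complex.I) - 1) ∂(expIntensity θ))
          ∂ρ := by
  obtain ⟨r, σ, hσ, hrσ⟩ := exists_cellLaw (expIntensity θ)
  set P₁ := cellLaw r σ
  have hpois := fun q => isPoissonProcess_coxMeasure hθ (isPoissonProcess_cellLaw r σ hrσ) q
  have hZm : Measurable fun p => toPointMeasure (coxMeasure θ p) :=
    measurable_toPointMeasure (measurable_coxMeasure θ) fun p => (isPointMeasure_coxMeasure θ p).2
  have hval : ∀ p, (toPointMeasure (coxMeasure θ p)).1 = coxMeasure θ p := fun p =>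
    toPointMeasure_val (isPointMeasure_coxMeasure θ p)
  refine ⟨ℝ≥0 × CellSample, inferInstance, ρ.prod P₁, inferInstance, Prod.fst,
    fun p => toPointMeasure (coxMeasure θ p), by simp [Measure.map_fst_prod],
    ⟨measurable_fst, hZm, ?_⟩, fun φ => ?_⟩
  · intro k B hB hb hd c
    have hset : MeasurableSet {p : ℝ≥0 × CellSample | ∀ i,
        (toPointMeasure (coxMeasure θ p)).1 (B i) = (c i : ℝ≥0∞)} := by
      simp_rw [hval]
      rw [Set.ofPred_forall]
      exact MeasurableSet.iInter fun i => measurableSet_eq_fun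
        ((Measure.measurable_coe (hB i)).comp (measurable_coxMeasure θ)) measurable_const
    have hg : ∀ q, P₁ {ω | ∀ i, coxMeasure θ (q, ω) (B i) = (c i : ℝ≥0∞)}
        = ∏ i, poissonMeasure (q * (expIntensity θ (B i)).toNNReal) {c i} := by
      intro q
      rw [(hpois q).measure_counts ((measurable_coxMeasure θ).comp measurable_prodMk_left)
        (fun ω => (isPointMeasure_coxMeasure θ _).1) hB hb hd c]
      simp
    have hgm : Measurable fun q : ℝ≥0 =>
        ∏ i, (poissonMeasure (q * (expIntensity θ (B i)).toNNReal)).real {c i} := by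
      simp_rw [poissonMeasure_real_singleton]
      fun_prop
    set A := {p : ℝ≥0 × CellSample | ∀ i,
        (toPointMeasure (coxMeasure θ p)).1 (B i) = (c i : ℝ≥0∞)} with hA
    have hgreal : ∀ q, ∫ ω, A.indicator (fun _ => (1 : ℝ)) (q, ω) ∂P₁
        = ∏ i, (poissonMeasure (q * (expIntensity θ (B i)).toNNReal)).real {c i} := by
      intro q
      have h1 : (fun ω => A.indicator (fun _ => (1 : ℝ)) (q, ω))
          = (Prod.mk q ⁻¹' A).indicator fun _ => (1 : ℝ) := rfl
      rw [h1, integral_indicator_const _ (hset.preimage measurable_prodMk_left), smul_eq_mul,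
        mul_one, measureReal_def]
      simp only [measureReal_def, ← ENNReal.toReal_prod, ← hg q]
      simp only [hA, hval]
      rfl
    have hint1 : Integrable (A.indicator fun _ => (1 : ℝ)) (ρ.prod P₁) :=
      (integrable_const 1).indicator hset
    have hint2 : Integrable (fun p : ℝ≥0 × CellSample =>
        ∏ i, (poissonMeasure (p.1 * (expIntensity θ (B i)).toNNReal)).real {c i}) (ρ.prod P₁) := by
      refine (integrable_const (1 : ℝ)).mono' (hgm.comp measurable_fst).aestronglyMeasurable
        (ae_of_all _ fun p => ?_)
      rw [Real.norm_eq_abs, abs_of_nonneg (Finset.prod_nonneg fun i _ => measureReal_nonneg)]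
      exact Finset.prod_le_one (fun i _ => measureReal_nonneg) fun i _ => measureReal_le_one
    refine (ae_eq_condExp_of_forall_setIntegral_eq measurable_fst.comap_le hint1
      (fun s _ _ => hint2.integrableOn) ?_ ?_).symm
    · rintro s ⟨S, hS, rfl⟩ -
      rw [← Set.prod_univ, setIntegral_prod _ hint2.integrableOn,
        setIntegral_prod _ hint1.integrableOn]
      simp only [Measure.restrict_univ, hgreal, integral_const, probReal_univ, one_smul]
    · exact (hgm.comp (comap_measurable _)).stronglyMeasurable.aestronglyMeasurable
  · rw [integral_prod]
    · refine integral_congr_ae (ae_of_all _ fun q => ?_)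
      simp_rw [hval]
      obtain ⟨C, hC⟩ := φ.continuous.bounded_above_of_compact_support φ.hasCompactSupport
      obtain ⟨R, hR⟩ := φ.hasCompactSupport.isCompact.isBounded.subset_closedBall 0
      rw [hpois q φ φ.continuous.measurable ⟨C, hC⟩ ⟨R, fun x hx => by
        by_contra h
        have := hR (subset_tsupport _ h)
        rw [mem_closedBall_zero_iff, Real.norm_eq_abs] at this
        linarith⟩, integral_smul_nnreal_measure]
      rfl
    · refine (integrable_const (1 : ℝ)).mono' (Measurable.aestronglyMeasurable ?_)
        (ae_of_all _ fun y => (Complex.norm_exp_ofReal_mul_I _).le)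
      exact ((Complex.measurable_ofReal.comp
        (PointMeasure.measurable_iff.1 hZm φ)).mul_const _).cexp

end

section

/-! ### Words and weights -/

/-- The words of length `n`. -/
abbrev Words (n : ℕ) : Type := {u : List ℕ // u.length = n}

instance : Unique (Words 0) where
  default := ⟨[], rfl⟩
  uniq u := Subtype.ext (List.length_eq_zero_iff.1 u.2)

/-- The word obtained from a word by adding a last generation. -/
def Words.child {n : ℕ} (u : Words n) (i : ℕ) : Words (n + 1) := ⟨i :: u.1, by simp [u.2]⟩

theorem Words.bijective_child (n : ℕ) :
    Function.Bijective fun p : Words n × ℕ => p.1.child p.2 := by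
  constructor
  · rintro ⟨⟨u, hu⟩, i⟩ ⟨⟨v, hv⟩, j⟩ h
    have h' : i :: u = j :: v := congrArg Subtype.val h
    simp only [List.cons.injEq] at h'
    simp [h'.1, h'.2]
  · rintro ⟨_ | ⟨i, u⟩, hu⟩
    · simp at hu
    · exact ⟨(⟨u, by simpa using hu⟩, i), rfl⟩

theorem tsum_words_succ {n : ℕ} (f : Words (n + 1) → ℝ≥0∞) :
    ∑' v, f v = ∑' u : Words n, ∑' i, f (u.child i) := by
  rw [← (Equiv.ofBijective _ (Words.bijective_child n)).tsum_eq, ENNReal.tsum_prod']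
  rfl

variable {Ω : Type*}

open Classical in
theorem tsum_generation (N : List ℕ → Ω → ℕ∞) (n : ℕ) (ω : Ω) (f : List ℕ → ℝ≥0∞) :
    ∑' u : generation N n ω, f u.1
      = ∑' u : Words n, if IsParticle N ω u.1 then f u.1 else 0 := by
  refine (tsum_subtype (generation N n ω) f).trans (Eq.trans ?_ (tsum_subtype
    {u : List ℕ | u.length = n} fun u => if IsParticle N ω u then f u else 0).symm)
  refine tsum_congr fun u => ?_
  simp only [Set.indicator_apply, generation, Set.mem_ofPred_eq]
  split_ifs <;> simp_all

/-- The logarithm `θ S_u - |u| k` of the weight of `u`. -/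
def logWeight (ξ : List ℕ → ℕ → Ω → ℝ) (θ k : ℝ) (u : List ℕ) (ω : Ω) : ℝ :=
  θ * position ξ ω u - u.length * k

open Classical in
/-- The weight `exp (θ S_u - |u| k)` of `u`, which is `0` if `u` is not a particle. -/
def weight (N : List ℕ → Ω → ℕ∞) (ξ : List ℕ → ℕ → Ω → ℝ) (θ k : ℝ) (u : List ℕ) (ω : Ω) :
    ℝ≥0∞ :=
  if IsParticle N ω u then ENNReal.ofReal (Real.exp (logWeight ξ θ k u ω)) else 0

open Classical in
/-- The weight of the `i`-th child, relative to its parent, as a function of the reproduction of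
the parent. -/
def childWeight (θ k : ℝ) (i : ℕ) (r : ℕ∞ × (ℕ → ℝ)) : ℝ≥0∞ :=
  if (i : ℕ∞) < r.1 then ENNReal.ofReal (Real.exp (θ * r.2 i - k)) else 0

section

variable (N : List ℕ → Ω → ℕ∞) (ξ : List ℕ → ℕ → Ω → ℝ) (θ k : ℝ)

theorem logWeight_cons (i : ℕ) (u : List ℕ) (ω : Ω) :
    logWeight ξ θ k (i :: u) ω
      = logWeight ξ θ k u ω + (θ * (offspring N ξ u ω).2 i - k) := by
  simp only [logWeight, position, offspring, List.length_cons]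
  push_cast
  ring

theorem weight_cons (i : ℕ) (u : List ℕ) (ω : Ω) :
    weight N ξ θ k (i :: u) ω
      = weight N ξ θ k u ω * childWeight θ k i (offspring N ξ u ω) := by
  simp only [weight, childWeight, logWeight_cons N, Real.exp_add, IsParticle]
  by_cases h1 : IsParticle N ω u <;> by_cases h2 : (i : ℕ∞) < N u ω <;>
    simp [h1, h2, offspring, ENNReal.ofReal_mul (Real.exp_pos _).le]

/-- The σ-algebra generated by the reproductions in the generations before `n`. -/
@[reducible]
def past (n : ℕ) : MeasurableSpace Ω :=
  ⨆ v ∈ {v : List ℕ | v.length < n}, MeasurableSpace.comap (offspring N ξ v) inferInstance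

theorem measurable_offspring_past {v : List ℕ} {n : ℕ} (h : v.length < n) :
    Measurable[past N ξ n] (offspring N ξ v) :=
  measurable_iff_comap_le.2
    (le_iSup₂ (f := fun (v : List ℕ) (_ : v ∈ {v : List ℕ | v.length < n}) =>
      MeasurableSpace.comap (offspring N ξ v) inferInstance) v h)

theorem past_mono {m n : ℕ} (h : m ≤ n) : past N ξ m ≤ past N ξ n :=
  iSup₂_le fun _ hv => (measurable_offspring_past N ξ (lt_of_lt_of_le hv h)).comap_le

theorem past_le [MeasurableSpace Ω] (h : ∀ u, Measurable (offspring N ξ u)) (n : ℕ) :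
    past N ξ n ≤ ‹MeasurableSpace Ω› :=
  iSup₂_le fun v _ => (h v).comap_le

theorem measurableSet_lt_fst (i : ℕ) :
    MeasurableSet {r : ℕ∞ × (ℕ → ℝ) | (i : ℕ∞) < r.1} :=
  (MeasurableSet.of_discrete (s := {n : ℕ∞ | (i : ℕ∞) < n})).preimage measurable_fst

theorem measurableSet_isParticle_past (u : List ℕ) :
    MeasurableSet[past N ξ u.length] {ω | IsParticle N ω u} := by
  induction u with
  | nil => exact MeasurableSet.univ
  | cons i u ih =>
    refine MeasurableSet.inter (past_mono N ξ (Nat.le_succ _) _ ih) ?_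
    exact measurable_offspring_past N ξ (Nat.lt_succ_self _) (measurableSet_lt_fst i)

theorem measurable_position_past (u : List ℕ) :
    Measurable[past N ξ u.length] fun ω => position ξ ω u := by
  induction u with
  | nil => exact measurable_const
  | cons i u ih =>
    refine Measurable.add (ih.mono (past_mono N ξ (Nat.le_succ _)) le_rfl) ?_
    exact ((measurable_pi_apply i).comp measurable_snd).comp
      (measurable_offspring_past N ξ (Nat.lt_succ_self _))

theorem measurable_logWeight_past (u : List ℕ) :
    Measurable[past N ξ u.length] (logWeight ξ θ k u) :=
  ((measurable_position_past N ξ u).const_mul θ).sub_const _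

theorem measurable_weight_past (u : List ℕ) :
    Measurable[past N ξ u.length] (weight N ξ θ k u) :=
  Measurable.ite (measurableSet_isParticle_past N ξ u)
    (measurable_logWeight_past N ξ θ k u).exp.ennreal_ofReal measurable_const

theorem measurable_childWeight (i : ℕ) : Measurable (childWeight θ k i) :=
  Measurable.ite (measurableSet_lt_fst i)
    (by fun_prop) measurable_const

/-- The law of the displacement of a child, biased by its weight. -/
def stepLaw (Λ : Measure (ℕ∞ × (ℕ → ℝ))) : Measure ℝ :=
  Measure.sum fun i => (Λ.withDensity (childWeight θ k i)).map fun r => θ * r.2 i - k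

theorem lintegral_stepLaw (Λ : Measure (ℕ∞ × (ℕ → ℝ))) {f : ℝ → ℝ≥0∞} (hf : Measurable f) :
    ∫⁻ x, f x ∂(stepLaw θ k Λ)
      = ∫⁻ r, ∑' i, childWeight θ k i r * f (θ * r.2 i - k) ∂Λ := by
  have hm : ∀ i : ℕ, Measurable fun r : ℕ∞ × (ℕ → ℝ) => θ * r.2 i - k := fun i => by fun_prop
  rw [stepLaw, lintegral_sum_measure]
  refine Eq.trans ?_ (lintegral_tsum fun i =>
    ((measurable_childWeight θ k i).mul (hf.comp (hm i))).aemeasurable).symm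
  refine tsum_congr fun i => ?_
  rw [lintegral_map hf (hm i)]
  exact lintegral_withDensity_eq_lintegral_mul _ (measurable_childWeight θ k i) (hf.comp (hm i))

/-- The sum of `exp (θ S_u - n k) f (θ S_u - n k)` over the particles of generation `n`. -/
def weightedSum (f : ℝ → ℝ≥0∞) (n : ℕ) (ω : Ω) : ℝ≥0∞ :=
  ∑' u : Words n, weight N ξ θ k u.1 ω * f (logWeight ξ θ k u.1 ω)

theorem measurable_weightedSum_past {f : ℝ → ℝ≥0∞} (hf : Measurable f) (n : ℕ) :
    Measurable[past N ξ n] (weightedSum N ξ θ k f n) := by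
  have h : ∀ u : Words n, Measurable[past N ξ n] fun ω =>
      weight N ξ θ k u.1 ω * f (logWeight ξ θ k u.1 ω) := fun u => by
    have h1 := measurable_weight_past N ξ θ k u.1
    have h2 := hf.comp (measurable_logWeight_past N ξ θ k u.1)
    rw [u.2] at h1 h2
    exact h1.mul h2
  let _ := past N ξ n
  exact Measurable.tsum h

variable [MeasurableSpace Ω] {P : Measure Ω} {N ξ}

theorem indep_past (hO : ∀ u, Measurable (offspring N ξ u))
    (hI : iIndepFun (fun u => offspring N ξ u) P) (u : List ℕ) :
    Indep (past N ξ u.length) (MeasurableSpace.comap (offspring N ξ u) inferInstance) P := by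
  have h := indep_iSup_of_disjoint (fun v => (hO v).comap_le) hI
    (S := {v : List ℕ | v.length < u.length}) (T := {u}) (by simp)
  simpa [past] using h

/-- The many-to-one step: summing over one more generation amounts to one more independent step of
the biased law. -/
theorem setLIntegral_weightedSum_succ [IsProbabilityMeasure P]
    (hO : ∀ u, Measurable (offspring N ξ u))
    (hI : iIndepFun (fun u => offspring N ξ u) P)
    (hD : ∀ u, IdentDistrib (offspring N ξ u) (offspring N ξ []) P P)
    {f : ℝ → ℝ≥0∞} (hf : Measurable f) (n : ℕ) {A : Set Ω} (hA : MeasurableSet[past N ξ n] A) :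
    ∫⁻ ω in A, weightedSum N ξ θ k f (n + 1) ω ∂P
      = ∫⁻ ω in A, weightedSum N ξ θ k
          (fun x => ∫⁻ y, f (x + y) ∂(stepLaw θ k (P.map (offspring N ξ [])))) n ω ∂P := by
  set Λ := P.map (offspring N ξ [])
  have : IsProbabilityMeasure Λ := Measure.isProbabilityMeasure_map (hO []).aemeasurable
  have hA' := past_le N ξ hO n _ hA
  let Φ : ℝ → ℕ∞ × (ℕ → ℝ) → ℝ≥0∞ := fun x r =>
    ∑' i, childWeight θ k i r * f (x + (θ * r.2 i - k))
  have hΦ : Measurable (Function.uncurry Φ) := by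
    refine Measurable.tsum fun i => ?_
    exact ((measurable_childWeight θ k i).comp measurable_snd).mul (hf.comp (by fun_prop))
  have hstep : ∀ x, ∫⁻ y, f (x + y) ∂(stepLaw θ k Λ) = ∫⁻ r, Φ x r ∂Λ := fun x =>
    lintegral_stepLaw θ k Λ (f := fun y => f (x + y)) (hf.comp (by fun_prop))
  have hF : Measurable fun x => ∫⁻ y, f (x + y) ∂(stepLaw θ k Λ) := by
    simp_rw [hstep]
    exact hΦ.lintegral_prod_right'
  have hw : ∀ u, Measurable (weight N ξ θ k u) := fun u =>
    (measurable_weight_past N ξ θ k u).mono (past_le N ξ hO _) le_rfl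
  have hl : ∀ u, Measurable (logWeight ξ θ k u) := fun u =>
    (measurable_logWeight_past N ξ θ k u).mono (past_le N ξ hO _) le_rfl
  have hsucc : ∀ ω, weightedSum N ξ θ k f (n + 1) ω = ∑' u : Words n,
      weight N ξ θ k u.1 ω * Φ (logWeight ξ θ k u.1 ω) (offspring N ξ u.1 ω) := by
    intro ω
    rw [weightedSum, tsum_words_succ]
    refine tsum_congr fun u => ?_
    rw [← ENNReal.tsum_mul_left]
    refine tsum_congr fun i => ?_
    rw [Words.child, weight_cons, logWeight_cons N, mul_assoc]
  simp_rw [hsucc]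
  refine (lintegral_tsum fun u : Words n => ((hw u.1).mul
    (hΦ.comp ((hl u.1).prodMk (hO u.1)))).aemeasurable).trans (Eq.trans ?_
    (lintegral_tsum fun u : Words n => ((hw u.1).mul (hF.comp (hl u.1))).aemeasurable).symm)
  refine tsum_congr fun u => ?_
  rw [← lintegral_indicator hA', ← lintegral_indicator hA']
  let X : Ω → ℝ≥0∞ × ℝ := fun ω => (A.indicator (weight N ξ θ k u.1) ω, logWeight ξ θ k u.1 ω)
  have hXpast : Measurable[past N ξ n] X := by
    have h1 := measurable_weight_past N ξ θ k u.1
    have h2 := measurable_logWeight_past N ξ θ k u.1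
    rw [u.2] at h1 h2
    exact (h1.indicator hA).prodMk h2
  have hX : Measurable X := hXpast.mono (past_le N ξ hO n) le_rfl
  have hind : IndepFun X (offspring N ξ u.1) P := by
    have h := indep_past hO hI u.1
    rw [u.2] at h
    exact (IndepFun_iff_Indep _ _ _).2 (indep_of_indep_of_le_left h hXpast.comap_le)
  have hprod := (indepFun_iff_map_prod_eq_prod_map_map hX.aemeasurable (hO u.1).aemeasurable).1 hind
  have hG : Measurable fun p : (ℝ≥0∞ × ℝ) × (ℕ∞ × (ℕ → ℝ)) => p.1.1 * Φ p.1.2 p.2 :=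
    (measurable_fst.comp measurable_fst).mul
      (hΦ.comp ((measurable_snd.comp measurable_fst).prodMk measurable_snd))
  calc ∫⁻ ω, A.indicator (fun ω => weight N ξ θ k u.1 ω *
          Φ (logWeight ξ θ k u.1 ω) (offspring N ξ u.1 ω)) ω ∂P
      = ∫⁻ ω, (X ω).1 * Φ (X ω).2 (offspring N ξ u.1 ω) ∂P := by
        refine lintegral_congr fun ω => ?_
        by_cases hω : ω ∈ A <;> simp [X, hω]
    _ = ∫⁻ p, p.1.1 * Φ p.1.2 p.2 ∂((P.map X).prod (P.map (offspring N ξ u.1))) := by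
        rw [← hprod, lintegral_map hG (hX.prodMk (hO u.1))]
    _ = ∫⁻ p, p.1 * ∫⁻ r, Φ p.2 r ∂Λ ∂(P.map X) := by
        rw [(hD u.1).map_eq, lintegral_prod _ hG.aemeasurable]
        refine lintegral_congr fun p => ?_
        have hp : Measurable (Φ p.2) := hΦ.comp (measurable_prodMk_left (x := p.2))
        exact lintegral_const_mul p.1 hp
    _ = _ := by
        have hm : Measurable fun p : ℝ≥0∞ × ℝ => p.1 * ∫⁻ r, Φ p.2 r ∂Λ :=
          measurable_fst.mul ((Measurable.lintegral_prod_right' hΦ).comp measurable_snd)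
        rw [lintegral_map hm hX]
        refine lintegral_congr fun ω => ?_
        by_cases hω : ω ∈ A <;> simp [X, hω, hstep]

end

end

section

/-! ### Walks, largest weights and the additive martingale -/

/-- The law of the `n`-th position of the random walk with step law `μ`. -/
def walkLaw (μ : Measure ℝ) : ℕ → Measure ℝ
  | 0 => Measure.dirac 0
  | n + 1 => walkLaw μ n ∗ μ

instance (μ : Measure ℝ) [IsProbabilityMeasure μ] (n : ℕ) :
    IsProbabilityMeasure (walkLaw μ n) := by
  induction n with
  | zero => exact inferInstanceAs (IsProbabilityMeasure (Measure.dirac 0))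
  | succ n ih => exact inferInstanceAs (IsProbabilityMeasure (walkLaw μ n ∗ μ))

theorem charFun_walkLaw (μ : Measure ℝ) [IsProbabilityMeasure μ] (n : ℕ) (t : ℝ) :
    charFun (walkLaw μ n) t = charFun μ t ^ n := by
  induction n with
  | zero => simp [walkLaw, charFun_dirac]
  | succ n ih => rw [walkLaw, charFun_conv, ih, pow_succ]

variable {Ω : Type*} {N : List ℕ → Ω → ℕ∞} {ξ : List ℕ → ℕ → Ω → ℝ} {Y : List ℕ → Ω → ℝ}
  {ν : Measure ℝ} {θ k : ℝ}

theorem childWeight_offspring_of_lt {i : ℕ} {u : List ℕ} {ω : Ω} (hi : (i : ℕ∞) < N u ω) :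
    childWeight θ k i (offspring N ξ u ω) = ENNReal.ofReal (Real.exp (θ * ξ u i ω - k)) :=
  if_pos hi

theorem childWeight_offspring_of_not_lt {i : ℕ} {u : List ℕ} {ω : Ω} (hi : ¬(i : ℕ∞) < N u ω) :
    childWeight θ k i (offspring N ξ u ω) = 0 :=
  if_neg hi

theorem weightedSum_zero (f : ℝ → ℝ≥0∞) (ω : Ω) : weightedSum N ξ θ k f 0 ω = f 0 := by
  rw [weightedSum, tsum_eq_single (default : Words 0) fun u hu => (hu (Subsingleton.elim _ _)).elim]
  simp [default, weight, IsParticle, logWeight, position]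

/-- The largest weight in generation `n`. -/
def maxWeight (N : List ℕ → Ω → ℕ∞) (ξ : List ℕ → ℕ → Ω → ℝ) (θ k : ℝ) (n : ℕ) (ω : Ω) : ℝ≥0∞ :=
  ⨆ u : Words n, weight N ξ θ k u.1 ω

theorem maxWeight_le_weightedSum_one (n : ℕ) (ω : Ω) :
    maxWeight N ξ θ k n ω ≤ weightedSum N ξ θ k (fun _ => 1) n ω :=
  iSup_le fun u => by
    refine le_trans (le_of_eq ?_) (ENNReal.le_tsum u)
    rw [mul_one]

variable [MeasurableSpace Ω] {P : Measure Ω}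

theorem measurable_weightedSum (h : IsLastProgenyModifiedBRW P N ξ Y ν) {f : ℝ → ℝ≥0∞}
    (hf : Measurable f) (n : ℕ) : Measurable (weightedSum N ξ θ k f n) :=
  (measurable_weightedSum_past N ξ θ k hf n).mono (past_le N ξ h.measurable_offspring n) le_rfl

theorem additiveMartingale_eq (n : ℕ) (ω : Ω) :
    additiveMartingale P N ξ θ n ω
      = weightedSum N ξ θ (kappa P N ξ θ).toReal (fun _ => 1) n ω := by
  rw [additiveMartingale, tsum_generation N n ω fun u =>
    ENNReal.ofReal (Real.exp (θ * position ξ ω u - n * (kappa P N ξ θ).toReal)), weightedSum]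
  refine tsum_congr fun u => ?_
  rw [mul_one, weight, logWeight, u.2]

theorem measurable_additiveLimit (h : IsLastProgenyModifiedBRW P N ξ Y ν) :
    Measurable (additiveLimit P N ξ θ) := by
  refine Measurable.limsup fun n => ?_
  simp_rw [funext (additiveMartingale_eq (P := P) (N := N) (ξ := ξ) (θ := θ) n)]
  exact measurable_weightedSum h measurable_const n

/-! ### Normalization by the log-Laplace transform -/

theorem lintegral_one_stepLaw (h : IsLastProgenyModifiedBRW P N ξ Y ν) :
    ∫⁻ _, 1 ∂(stepLaw θ k (P.map (offspring N ξ [])))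
      = ENNReal.ofReal (Real.exp (-k)) *
        ∫⁻ ω, ∑' u : generation N 1 ω, ENNReal.ofReal (Real.exp (θ * position ξ ω u.1)) ∂P := by
  rw [lintegral_stepLaw θ k _ measurable_const, lintegral_map
    (Measurable.tsum fun i => (measurable_childWeight θ k i).mul_const _)
    (h.measurable_offspring []), ← lintegral_const_mul' _ _ ENNReal.ofReal_ne_top]
  refine lintegral_congr fun ω => ?_
  rw [tsum_generation N 1 ω fun u => ENNReal.ofReal (Real.exp (θ * position ξ ω u)),
    tsum_words_succ, tsum_eq_single (default : Words 0)
      fun u hu => (hu (Subsingleton.elim _ _)).elim, ← ENNReal.tsum_mul_left]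
  refine tsum_congr fun i => ?_
  have h1 : IsParticle N ω ((default : Words 0).child i).1 ↔ (i : ℕ∞) < N [] ω :=
    ⟨fun h => h.2, fun h => ⟨trivial, h⟩⟩
  have h2 : position ξ ω ((default : Words 0).child i).1 = ξ [] i ω := zero_add _
  by_cases hi : (i : ℕ∞) < N [] ω
  · rw [if_pos (h1.2 hi), childWeight_offspring_of_lt hi, h2, mul_one,
      ← ENNReal.ofReal_mul (Real.exp_pos _).le, ← Real.exp_add]
    congr 2
    ring
  · rw [if_neg (h1.not.2 hi), childWeight_offspring_of_not_lt hi, zero_mul, mul_zero]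

theorem isProbabilityMeasure_stepLaw (h : IsLastProgenyModifiedBRW P N ξ Y ν)
    (hnondeg : ∀ x : ℝ, 0 < P {ω | ∃ u ∈ generation N 1 ω, position ξ ω u ≠ x})
    (hκ : kappa P N ξ θ < ⊤) :
    IsProbabilityMeasure (stepLaw θ (kappa P N ξ θ).toReal (P.map (offspring N ξ []))) := by
  set Z := ∫⁻ ω, ∑' u : generation N 1 ω, ENNReal.ofReal (Real.exp (θ * position ξ ω u.1)) ∂P
    with hZ
  have hZtop : Z ≠ ∞ := by
    intro hZ'
    rw [kappa, ← hZ, hZ', ENNReal.log_top] at hκ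
    exact lt_irrefl _ hκ
  have hZpos : Z ≠ 0 := by
    intro hZ'
    have hm : Measurable fun ω =>
        ∑' u : generation N 1 ω, ENNReal.ofReal (Real.exp (θ * position ξ ω u.1)) := by
      simp_rw [fun ω => tsum_generation N 1 ω fun u =>
        ENNReal.ofReal (Real.exp (θ * position ξ ω u))]
      exact Measurable.tsum fun u => Measurable.ite
        (past_le N ξ h.measurable_offspring _ _ (measurableSet_isParticle_past N ξ u.1))
        (((measurable_position_past N ξ u.1).mono (past_le N ξ h.measurable_offspring _)
          le_rfl).const_mul θ).exp.ennreal_ofReal measurable_const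
    have h0 := (lintegral_eq_zero_iff hm).1 hZ'
    refine (hnondeg 0).ne' (measure_mono_null ?_ (ae_iff.1 h0))
    rintro ω ⟨u, hu, -⟩ hω
    have := ENNReal.tsum_eq_zero.1 hω ⟨u, hu⟩
    simp only [ENNReal.ofReal_eq_zero] at this
    exact absurd this (not_le.2 (Real.exp_pos _))
  have hk : Real.exp (kappa P N ξ θ).toReal = Z.toReal := by
    rw [kappa, ENNReal.log_pos_real hZpos hZtop, EReal.toReal_coe,
      Real.exp_log (ENNReal.toReal_pos hZpos hZtop)]
  constructor
  rw [← lintegral_one, lintegral_one_stepLaw h, ← hZ, Real.exp_neg, hk,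
    ENNReal.ofReal_inv_of_pos (ENNReal.toReal_pos hZpos hZtop), ENNReal.ofReal_toReal hZtop,
    ENNReal.inv_mul_cancel hZpos hZtop]

theorem stepLaw_compl_singleton_ne_zero (h : IsLastProgenyModifiedBRW P N ξ Y ν)
    (hnondeg : ∀ x : ℝ, 0 < P {ω | ∃ u ∈ generation N 1 ω, position ξ ω u ≠ x}) (hθ : θ ≠ 0)
    (x : ℝ) : stepLaw θ k (P.map (offspring N ξ [])) {x}ᶜ ≠ 0 := by
  intro h0
  have hB : MeasurableSet ({x}ᶜ : Set ℝ) := (measurableSet_singleton x).compl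
  have hm : Measurable fun r : ℕ∞ × (ℕ → ℝ) =>
      ∑' i, childWeight θ k i r * ({x}ᶜ : Set ℝ).indicator 1 (θ * r.2 i - k) :=
    Measurable.tsum fun i => (measurable_childWeight θ k i).mul
      ((measurable_one.indicator hB).comp (by fun_prop))
  rw [← lintegral_indicator_one hB, lintegral_stepLaw θ k _ (measurable_one.indicator hB),
    lintegral_map hm (h.measurable_offspring [])] at h0
  replace h0 := (lintegral_eq_zero_iff (hm.comp (h.measurable_offspring []))).1 h0
  refine (hnondeg ((x + k) / θ)).ne' (measure_mono_null ?_ (ae_iff.1 h0))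
  rintro ω ⟨u, hu, hux⟩ hω
  obtain ⟨i, rfl⟩ := List.length_eq_one_iff.1 hu.1
  have hi : (i : ℕ∞) < N [] ω := hu.2.2
  have hpos : position ξ ω [i] = ξ [] i ω := zero_add _
  have := ENNReal.tsum_eq_zero.1 hω i
  rw [hpos] at hux
  have hne : θ * ξ [] i ω - k ∈ ({x}ᶜ : Set ℝ) := fun hx => hux (by
    rw [Set.mem_singleton_iff] at hx
    field_simp
    linarith)
  rw [childWeight_offspring_of_lt hi, show (offspring N ξ [] ω).2 i = ξ [] i ω from rfl,
    Set.indicator_of_mem hne, Pi.one_apply, mul_one, ENNReal.ofReal_eq_zero] at this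
  exact absurd this (not_le.2 (Real.exp_pos _))

/-! ### The many-to-one formula -/

variable [IsProbabilityMeasure P]

/-- The many-to-one formula. -/
theorem lintegral_weightedSum (h : IsLastProgenyModifiedBRW P N ξ Y ν)
    [IsProbabilityMeasure (stepLaw θ k (P.map (offspring N ξ [])))]
    {f : ℝ → ℝ≥0∞} (hf : Measurable f) (n : ℕ) :
    ∫⁻ ω, weightedSum N ξ θ k f n ω ∂P
      = ∫⁻ x, f x ∂(walkLaw (stepLaw θ k (P.map (offspring N ξ []))) n) := by
  set μ := stepLaw θ k (P.map (offspring N ξ []))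
  induction n generalizing f with
  | zero =>
    simp_rw [weightedSum_zero, walkLaw]
    rw [lintegral_dirac' _ hf]
    simp
  | succ n ih =>
    have hF : Measurable fun x => ∫⁻ y, f (x + y) ∂μ :=
      Measurable.lintegral_prod_right' (f := fun p : ℝ × ℝ => f (p.1 + p.2)) (by fun_prop)
    rw [walkLaw, Measure.lintegral_conv hf, ← ih hF]
    have := setLIntegral_weightedSum_succ θ k h.measurable_offspring h.iIndepFun_offspring
      h.identDistrib_offspring hf n MeasurableSet.univ
    simpa only [Measure.restrict_univ] using this

theorem lintegral_weightedSum_one (h : IsLastProgenyModifiedBRW P N ξ Y ν)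
    [IsProbabilityMeasure (stepLaw θ k (P.map (offspring N ξ [])))] (n : ℕ) :
    ∫⁻ ω, weightedSum N ξ θ k (fun _ => 1) n ω ∂P = 1 := by
  rw [lintegral_weightedSum h measurable_const]
  simp

theorem ae_weightedSum_one_lt_top (h : IsLastProgenyModifiedBRW P N ξ Y ν)
    [IsProbabilityMeasure (stepLaw θ k (P.map (offspring N ξ [])))] (n : ℕ) :
    ∀ᵐ ω ∂P, weightedSum N ξ θ k (fun _ => 1) n ω < ∞ :=
  ae_lt_top (measurable_weightedSum h measurable_const n)
    (by rw [lintegral_weightedSum_one h]; exact ENNReal.one_ne_top)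

/-- The filtration of the generations. -/
def generationFiltration (h : IsLastProgenyModifiedBRW P N ξ Y ν) :
    Filtration ℕ ‹MeasurableSpace Ω› where
  seq := past N ξ
  mono' _ _ hmn := past_mono N ξ hmn
  le' := past_le N ξ h.measurable_offspring

theorem martingale_weightedSum (h : IsLastProgenyModifiedBRW P N ξ Y ν)
    [IsProbabilityMeasure (stepLaw θ k (P.map (offspring N ξ [])))] :
    Martingale (fun n ω => (weightedSum N ξ θ k (fun _ => 1) n ω).toReal)
      (generationFiltration h) P := by
  have hm : ∀ n, Measurable (weightedSum N ξ θ k (fun _ => 1) n) := fun n =>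
    measurable_weightedSum h measurable_const n
  have hint : ∀ n, Integrable (fun ω => (weightedSum N ξ θ k (fun _ => 1) n ω).toReal) P :=
    fun n => integrable_toReal_of_lintegral_ne_top (hm n).aemeasurable
      (by rw [lintegral_weightedSum_one h]; exact ENNReal.one_ne_top)
  have hmp : ∀ n, Measurable[past N ξ n] fun ω =>
      (weightedSum N ξ θ k (fun _ => 1) n ω).toReal := fun n =>
    (measurable_weightedSum_past N ξ θ k measurable_const n).ennreal_toReal
  refine martingale_nat (fun n => (hmp n).stronglyMeasurable) hint fun n => ?_
  refine ae_eq_condExp_of_forall_setIntegral_eq (past_le N ξ h.measurable_offspring n)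
    (hint (n + 1)) (fun _ _ _ => (hint n).integrableOn) (fun A hA _ => ?_)
    (hmp n).stronglyMeasurable.aestronglyMeasurable
  rw [integral_toReal (hm n).aemeasurable (ae_restrict_of_ae (ae_weightedSum_one_lt_top h n)),
    integral_toReal (hm _).aemeasurable (ae_restrict_of_ae (ae_weightedSum_one_lt_top h _)),
    setLIntegral_weightedSum_succ θ k h.measurable_offspring h.iIndepFun_offspring
      h.identDistrib_offspring measurable_const n hA]
  simp

theorem ae_exists_tendsto_weightedSum (h : IsLastProgenyModifiedBRW P N ξ Y ν)
    [IsProbabilityMeasure (stepLaw θ k (P.map (offspring N ξ [])))] :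
    ∀ᵐ ω ∂P, ∃ w : ℝ≥0∞, w < ∞ ∧
      Tendsto (fun n => weightedSum N ξ θ k (fun _ => 1) n ω) atTop (𝓝 w) := by
  have hbdd : ∀ n, eLpNorm (fun ω => (weightedSum N ξ θ k (fun _ => 1) n ω).toReal) 1 P
      ≤ (1 : ℝ≥0) := by
    intro n
    rw [eLpNorm_one_eq_lintegral_enorm, ENNReal.coe_one]
    refine le_trans (lintegral_mono fun ω => ?_)
      (lintegral_weightedSum_one (θ := θ) (k := k) h n).le
    rw [Real.enorm_eq_ofReal ENNReal.toReal_nonneg]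
    exact ENNReal.ofReal_toReal_le
  filter_upwards [(martingale_weightedSum h).submartingale.exists_ae_tendsto_of_bdd hbdd,
    ae_all_iff.2 (ae_weightedSum_one_lt_top (θ := θ) (k := k) h)] with ω ⟨_, h1⟩ h2
  refine ⟨_, ENNReal.ofReal_lt_top, (ENNReal.tendsto_ofReal h1).congr fun n => ?_⟩
  exact ENNReal.ofReal_toReal (h2 n).ne

/-! ### The largest weight -/

theorem tendsto_measure_exists_weight_gt (h : IsLastProgenyModifiedBRW P N ξ Y ν)
    [IsProbabilityMeasure (stepLaw θ k (P.map (offspring N ξ [])))]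
    (hμ : ∀ x, stepLaw θ k (P.map (offspring N ξ [])) {x}ᶜ ≠ 0) {ε : ℝ} (hε : 0 < ε) :
    Tendsto (fun n => P {ω | ∃ u : Words n, ENNReal.ofReal ε < weight N ξ θ k u.1 ω}) atTop
      (𝓝 0) := by
  set μ := stepLaw θ k (P.map (offspring N ξ []))
  set f : ℝ → ℝ≥0∞ := (Set.Ici (Real.log ε)).indicator fun x => ENNReal.ofReal (Real.exp (-x))
  have hf : Measurable f := Measurable.indicator (by fun_prop) measurableSet_Ici
  refine tendsto_of_tendsto_of_tendsto_of_le_of_le tendsto_const_nhds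
    (tendsto_lintegral_exp_neg_Ici μ hμ (walkLaw μ) (charFun_walkLaw μ) (Real.log ε))
    (fun _ => zero_le) fun n => ?_
  rw [← lintegral_indicator measurableSet_Ici, ← lintegral_weightedSum h hf]
  have hmar := mul_meas_ge_le_lintegral (μ := P)
    (measurable_weightedSum (θ := θ) (k := k) h hf n) 1
  rw [one_mul] at hmar
  refine (measure_mono ?_).trans hmar
  rintro ω ⟨u, hu⟩
  have hpart : IsParticle N ω u.1 := by
    by_contra hp
    simp [weight, hp] at hu
  rw [weight, if_pos hpart, ENNReal.ofReal_lt_ofReal_iff (Real.exp_pos _)] at hu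
  have hlog : Real.log ε ≤ logWeight ξ θ k u.1 ω :=
    ((Real.log_lt_iff_lt_exp hε).2 hu).le
  refine le_trans (le_of_eq ?_) (ENNReal.le_tsum u)
  have hfu : f (logWeight ξ θ k u.1 ω) = ENNReal.ofReal (Real.exp (-logWeight ξ θ k u.1 ω)) :=
    Set.indicator_of_mem (show _ ∈ Set.Ici _ from hlog) _
  rw [weight, if_pos hpart, hfu,
    ← ENNReal.ofReal_mul (Real.exp_pos _).le, ← Real.exp_add, add_neg_cancel, Real.exp_zero,
    ENNReal.ofReal_one]

theorem tendstoInMeasure_maxWeight (h : IsLastProgenyModifiedBRW P N ξ Y ν)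
    [IsProbabilityMeasure (stepLaw θ k (P.map (offspring N ξ [])))]
    (hμ : ∀ x, stepLaw θ k (P.map (offspring N ξ [])) {x}ᶜ ≠ 0) :
    TendstoInMeasure P (fun n ω => (maxWeight N ξ θ k n ω).toReal) atTop (fun _ => 0) := by
  refine tendstoInMeasure_of_ne_top fun ε hε hε' => ?_
  have hpos : 0 < ε.toReal / 2 := half_pos (ENNReal.toReal_pos hε.ne' hε')
  refine tendsto_of_tendsto_of_tendsto_of_le_of_le tendsto_const_nhds
    (tendsto_measure_exists_weight_gt h hμ hpos) (fun _ => zero_le)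
    fun n => measure_mono fun ω hω => ?_
  have h1 : ε ≤ maxWeight N ξ θ k n ω := by
    refine le_trans hω ?_
    rw [edist_zero_right, Real.enorm_eq_ofReal ENNReal.toReal_nonneg]
    exact ENNReal.ofReal_toReal_le
  refine lt_iSup_iff.1 (lt_of_lt_of_le ?_ h1)
  rw [← ENNReal.ofReal_toReal hε', ENNReal.toReal_ofReal ENNReal.toReal_nonneg]
  exact (ENNReal.ofReal_lt_ofReal_iff (ENNReal.toReal_pos hε.ne' hε')).2 (half_lt_self
    (ENNReal.toReal_pos hε.ne' hε'))

/-! ### Convergence of the additive martingale -/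

theorem ae_tendsto_additiveMartingale (h : IsLastProgenyModifiedBRW P N ξ Y ν)
    [IsProbabilityMeasure (stepLaw θ (kappa P N ξ θ).toReal (P.map (offspring N ξ [])))] :
    ∀ᵐ ω ∂P, additiveLimit P N ξ θ ω < ∞ ∧
      Tendsto (fun n => additiveMartingale P N ξ θ n ω) atTop (𝓝 (additiveLimit P N ξ θ ω)) := by
  filter_upwards [ae_exists_tendsto_weightedSum (θ := θ) (k := (kappa P N ξ θ).toReal) h]
    with ω ⟨w, hw, ht⟩
  simp_rw [← additiveMartingale_eq] at ht
  have : additiveLimit P N ξ θ ω = w := ht.limsup_eq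
  rw [this]
  exact ⟨hw, ht⟩

end

section

/-! ### Products of factors close to one -/

theorem norm_one_add_sub_exp_le {z : ℂ} (h1 : ‖1 + z‖ ≤ 1) (hre : z.re ≤ 0) :
    ‖1 + z - Complex.exp z‖ ≤ 2 * ‖z‖ ^ 2 := by
  by_cases hz : ‖z‖ ≤ 1
  · have := Complex.norm_exp_sub_one_sub_id_le hz
    rw [norm_sub_rev, show Complex.exp z - (1 + z) = Complex.exp z - 1 - z by ring]
    nlinarith [sq_nonneg ‖z‖]
  · have h2 : ‖Complex.exp z‖ ≤ 1 := by
      rw [Complex.norm_exp]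
      exact Real.exp_le_one_iff.2 hre
    have h3 : 1 ≤ ‖z‖ ^ 2 := one_le_pow₀ (not_le.1 hz).le
    linarith [norm_sub_le (1 + z) (Complex.exp z)]

theorem norm_prod_one_add_sub_exp_le {ι : Type*} (s : Finset ι) {z : ι → ℂ}
    (h1 : ∀ i, ‖1 + z i‖ ≤ 1) (hre : ∀ i, (z i).re ≤ 0) :
    ‖∏ i ∈ s, (1 + z i) - Complex.exp (∑ i ∈ s, z i)‖ ≤ ∑ i ∈ s, 2 * ‖z i‖ ^ 2 := by
  classical
  induction s using Finset.induction_on with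
  | empty => simp
  | insert i s hi ih =>
    rw [Finset.prod_insert hi, Finset.sum_insert hi, Finset.sum_insert hi, Complex.exp_add]
    have hexp : ‖Complex.exp (∑ j ∈ s, z j)‖ ≤ 1 := by
      rw [Complex.norm_exp, Complex.re_sum]
      exact Real.exp_le_one_iff.2 (Finset.sum_nonpos fun j _ => hre j)
    calc ‖(1 + z i) * ∏ j ∈ s, (1 + z j) - Complex.exp (z i) * Complex.exp (∑ j ∈ s, z j)‖
        = ‖(1 + z i - Complex.exp (z i)) * Complex.exp (∑ j ∈ s, z j)
          + (1 + z i) * (∏ j ∈ s, (1 + z j) - Complex.exp (∑ j ∈ s, z j))‖ := by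
          congr 1; ring
      _ ≤ ‖1 + z i - Complex.exp (z i)‖ * ‖Complex.exp (∑ j ∈ s, z j)‖
          + ‖1 + z i‖ * ‖∏ j ∈ s, (1 + z j) - Complex.exp (∑ j ∈ s, z j)‖ := by
          rw [← norm_mul, ← norm_mul]
          exact norm_add_le _ _
      _ ≤ 2 * ‖z i‖ ^ 2 * 1 + 1 * ∑ j ∈ s, 2 * ‖z j‖ ^ 2 := by
          gcongr
          · exact norm_one_add_sub_exp_le (h1 i) (hre i)
          · exact h1 i
      _ = _ := by ring

theorem norm_tprod_one_add_sub_exp_le {ι : Type*} {z : ι → ℂ} {w : ι → ℝ} {C M : ℝ}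
    (h1 : ∀ i, ‖1 + z i‖ ≤ 1) (hre : ∀ i, (z i).re ≤ 0) (hw : ∀ i, 0 ≤ w i)
    (hzw : ∀ i, ‖z i‖ ≤ C * w i) (hM : ∀ i, w i ≤ M) (hs : Summable w) :
    ‖∏' i, (1 + z i) - Complex.exp (∑' i, z i)‖ ≤ 2 * C ^ 2 * M * ∑' i, w i := by
  have hz : Summable fun i => ‖z i‖ := Summable.of_nonneg_of_le (fun _ => norm_nonneg _) hzw
    (hs.mul_left C)
  have hp := (Complex.multipliable_one_add_of_summable hz.of_norm).hasProd
  have hsum := (hz.of_norm).hasSum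
  refine le_of_tendsto (hp.sub ((Complex.continuous_exp.tendsto _).comp hsum)).norm
    (Eventually.of_forall fun s => ?_)
  refine (norm_prod_one_add_sub_exp_le s h1 hre).trans ?_
  calc ∑ i ∈ s, 2 * ‖z i‖ ^ 2 ≤ ∑ i ∈ s, 2 * C ^ 2 * M * w i := by
        refine Finset.sum_le_sum fun i _ => ?_
        calc 2 * ‖z i‖ ^ 2 ≤ 2 * (C * w i) ^ 2 := by gcongr; exact hzw i
          _ = 2 * C ^ 2 * w i * w i := by ring
          _ ≤ 2 * C ^ 2 * M * w i := by
            have := hM i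
            have := hw i
            gcongr
    _ = 2 * C ^ 2 * M * ∑ i ∈ s, w i := by rw [Finset.mul_sum]
    _ ≤ 2 * C ^ 2 * M * ∑' i, w i := by
        by_cases hι : Nonempty ι
        · have hM0 : 0 ≤ M := (hw hι.some).trans (hM _)
          gcongr
          exact hs.sum_le_tsum s fun i _ => hw i
        · have := not_nonempty_iff.1 hι
          simp [Finset.eq_empty_of_isEmpty s]

/-- Convergence of products of factors close to one, when the largest deviation tends to zero. -/
theorem tendsto_tprod_one_add {ι : ℕ → Type*} {w : ∀ n, ι n → ℝ} {z : ∀ n, ι n → ℂ}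
    {M : ℕ → ℝ} {W C : ℝ}
    {c : ℂ} (h1 : ∀ n i, ‖1 + z n i‖ ≤ 1) (hre : ∀ n i, (z n i).re ≤ 0) (hw : ∀ n i, 0 ≤ w n i)
    (hzw : ∀ n i, ‖z n i‖ ≤ C * w n i) (hM : ∀ n i, w n i ≤ M n)
    (hs : ∀ n, Summable (w n)) (hM0 : Tendsto M atTop (𝓝 0))
    (hW : Tendsto (fun n => ∑' i, w n i) atTop (𝓝 W))
    (happ : ∀ η > 0, ∃ ρ > 0, ∀ n i, w n i ≤ ρ → ‖z n i - w n i * c‖ ≤ η * w n i) :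
    Tendsto (fun n => ∏' i, (1 + z n i)) atTop (𝓝 (Complex.exp (W * c))) := by
  have hz : ∀ n, Summable fun i => ‖z n i‖ := fun n =>
    Summable.of_nonneg_of_le (fun _ => norm_nonneg _) (hzw n) ((hs n).mul_left C)
  have hlim1 : Tendsto (fun n => ∏' i, (1 + z n i) - Complex.exp (∑' i, z n i)) atTop (𝓝 0) := by
    refine squeeze_zero_norm (fun n => norm_tprod_one_add_sub_exp_le (h1 n) (hre n) (hw n)
      (hzw n) (hM n) (hs n)) ?_
    have := (hM0.const_mul (2 * C ^ 2)).mul hW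
    simpa using this
  have hlim2 : Tendsto (fun n => ∑' i, z n i - ((∑' i, w n i : ℝ) : ℂ) * c) atTop (𝓝 0) := by
    rw [Metric.tendsto_nhds]
    intro ε hε
    have hW0 : 0 ≤ W := ge_of_tendsto' hW fun n => tsum_nonneg (hw n)
    obtain ⟨ρ, hρ, hρz⟩ := happ (ε / (2 * (W + 1))) (by positivity)
    filter_upwards [hM0.eventually_lt_const hρ, hW.eventually_lt_const (lt_add_one W)]
      with n hn1 hn2
    have hsc : Summable fun i => ((w n i : ℝ) : ℂ) * c :=
      (Complex.ofRealCLM.summable (hs n)).mul_right c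
    rw [dist_zero_right, Complex.ofReal_tsum, ← tsum_mul_right, ← (hz n).of_norm.tsum_sub hsc]
    have hb : ∀ i, ‖z n i - w n i * c‖ ≤ ε / (2 * (W + 1)) * w n i := fun i =>
      hρz n i ((hM n i).trans hn1.le)
    calc ‖∑' i, (z n i - w n i * c)‖ ≤ ε / (2 * (W + 1)) * ∑' i, w n i :=
          tsum_of_norm_bounded ((hs n).hasSum.mul_left _) hb
      _ ≤ ε / (2 * (W + 1)) * (W + 1) := by gcongr
      _ = ε / 2 := by field_simp
      _ < ε := half_lt_self hε
  have hlim3 : Tendsto (fun n => Complex.exp (∑' i, z n i)) atTop (𝓝 (Complex.exp (W * c))) := by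
    refine (Complex.continuous_exp.tendsto _).comp ?_
    have := hlim2.add (((Complex.continuous_ofReal.tendsto W).comp hW).mul_const c)
    simpa using this
  have := hlim1.add hlim3
  simpa using this

/-! ### Vague convergence from intervals -/

theorem exists_step_approx {f : ℝ → ℂ} (hf : Continuous f) {R : ℝ} (hR0 : 0 ≤ R)
    (hR : ∀ x, R < |x| → f x = 0) {ε : ℝ} (hε : 0 < ε) :
    ∃ (n : ℕ) (a : ℕ → ℝ), Monotone a ∧ ∀ x, ‖f x -
      ∑ i ∈ Finset.range n, (Set.Ico (a i) (a (i + 1))).indicator (fun _ => f (a i)) x‖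
        ≤ (Set.Ico (-R) (R + 1)).indicator (fun _ => ε) x := by
  have huc : UniformContinuous f :=
    hf.uniformContinuous_of_tendsto_cocompact
      (HasCompactSupport.intro (isCompact_Icc (a := -R) (b := R)) fun x hx => hR x
        (not_le.1 fun h => hx (abs_le.1 h))).is_zero_at_infty
  obtain ⟨δ, hδ, hδf⟩ := Metric.uniformContinuous_iff.1 huc ε hε
  obtain ⟨n, hn⟩ := exists_nat_gt ((2 * R + 1) / δ)
  have hnpos : (0 : ℝ) < n := lt_of_le_of_lt (by positivity) hn
  set d := (2 * R + 1) / n with hd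
  have hdpos : 0 < d := by positivity
  have hdδ : d < δ := by
    rw [hd, div_lt_iff₀ hnpos]
    rw [div_lt_iff₀ hδ] at hn
    linarith
  have hnd : n * d = 2 * R + 1 := by rw [hd]; field_simp
  refine ⟨n, fun i => -R + i * d, fun i j hij => ?_, fun x => ?_⟩
  · have : (i : ℝ) ≤ j := by exact_mod_cast hij
    simp only
    gcongr
  · by_cases hx : x ∈ Set.Ico (-R) (R + 1)
    · set j := ⌊(x + R) / d⌋₊
      have hq : 0 ≤ (x + R) / d := div_nonneg (by linarith [hx.1]) hdpos.le
      have hj1 : j * d ≤ x + R := (le_div_iff₀ hdpos).1 (Nat.floor_le hq)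
      have hj2 : x + R < (j + 1) * d := (div_lt_iff₀ hdpos).1 (Nat.lt_floor_add_one _)
      have hjn : j < n := by
        have : (j : ℝ) * d < n * d := by linarith [hx.2]
        exact_mod_cast lt_of_mul_lt_mul_right this hdpos.le
      have hmem : ∀ i : ℕ, x ∈ Set.Ico (-R + i * d) (-R + (i + 1 : ℕ) * d) ↔ i = j := by
        intro i
        constructor
        · rintro ⟨h1, h2⟩
          symm
          rw [Nat.floor_eq_iff hq, le_div_iff₀ hdpos, div_lt_iff₀ hdpos]
          push_cast at h2
          constructor <;> linarith
        · rintro rfl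
          constructor
          · linarith
          · push_cast; linarith
      rw [Finset.sum_eq_single j
        (fun i _ hi => Set.indicator_of_notMem (fun h => hi ((hmem i).1 h)) _)
        (fun h => (h (Finset.mem_range.2 hjn)).elim), Set.indicator_of_mem ((hmem j).2 rfl),
        Set.indicator_of_mem hx, ← dist_eq_norm]
      refine (hδf ?_).le
      rw [Real.dist_eq, abs_of_nonneg (by linarith)]
      linarith
    · have hfx : f x = 0 := by
        rcases lt_or_ge x (-R) with h | h
        · exact hR x (lt_of_lt_of_le (by linarith) (neg_le_abs x))
        · have : R + 1 ≤ x := not_lt.1 fun h' => hx ⟨h, h'⟩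
          exact hR x (lt_of_lt_of_le (by linarith) (le_abs_self x))
      rw [Set.indicator_of_notMem hx, hfx, Finset.sum_eq_zero]
      · simp
      · intro i hi
        refine Set.indicator_of_notMem (fun h => hx ⟨?_, ?_⟩) _
        · exact le_trans (le_add_of_nonneg_right (by positivity)) h.1
        · refine lt_of_lt_of_le h.2 ?_
          have h1 : ((i + 1 : ℕ) : ℝ) ≤ n := by exact_mod_cast Finset.mem_range.1 hi
          have h2 := mul_le_mul_of_nonneg_right h1 hdpos.le
          linarith

/-- Convergence of the masses of intervals implies convergence of the integrals of compactly
supported continuous functions. -/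
theorem tendsto_integral_of_tendsto_Ico {ι : Type*} {l : Filter ι} {m : ι → Measure ℝ}
    {m₀ : Measure ℝ} [∀ i, IsLocallyFiniteMeasure (m i)] [IsLocallyFiniteMeasure m₀]
    (h : ∀ a b, a ≤ b → Tendsto (fun i => (m i).real (Set.Ico a b)) l (𝓝 (m₀.real (Set.Ico a b))))
    {f : ℝ → ℂ} (hf : Continuous f) (hfc : HasCompactSupport f) :
    Tendsto (fun i => ∫ x, f x ∂(m i)) l (𝓝 (∫ x, f x ∂m₀)) := by
  obtain ⟨R', hR'⟩ := hfc.isCompact.isBounded.subset_closedBall 0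
  set R := max R' 0
  have hR : ∀ x, R < |x| → f x = 0 := fun x hx => by
    by_contra hne
    have := hR' (subset_tsupport _ hne)
    rw [mem_closedBall_zero_iff, Real.norm_eq_abs] at this
    linarith [le_max_left R' 0]
  have hfin : ∀ (ρ : Measure ℝ) [IsLocallyFiniteMeasure ρ] (a b : ℝ), ρ (Set.Ico a b) ≠ ∞ :=
    fun ρ _ a b => ((measure_mono Set.Ico_subset_Icc_self).trans_lt isCompact_Icc.measure_lt_top).ne
  rw [Metric.tendsto_nhds]
  intro η hη
  set K := m₀.real (Set.Ico (-R) (R + 1))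
  have hK : 0 ≤ K := measureReal_nonneg
  obtain ⟨n, a, ha, happ⟩ := exists_step_approx hf (le_max_right R' 0) hR
    (ε := η / (4 * (K + 1))) (by positivity)
  have hcomp : ∀ (ρ : Measure ℝ) [IsLocallyFiniteMeasure ρ],
      ‖∫ x, f x ∂ρ - ∑ i ∈ Finset.range n, (ρ.real (Set.Ico (a i) (a (i + 1))) : ℂ) * f (a i)‖
        ≤ η / (4 * (K + 1)) * ρ.real (Set.Ico (-R) (R + 1)) := by
    intro ρ _
    have hind : ∀ i, Integrable ((Set.Ico (a i) (a (i + 1))).indicator fun _ => f (a i)) ρ :=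
      fun i => (integrable_indicator_iff measurableSet_Ico).2 (integrableOn_const (hfin ρ _ _))
    have hs : ∑ i ∈ Finset.range n, (ρ.real (Set.Ico (a i) (a (i + 1))) : ℂ) * f (a i)
        = ∫ x, ∑ i ∈ Finset.range n, (Set.Ico (a i) (a (i + 1))).indicator (fun _ => f (a i)) x
          ∂ρ := by
      rw [integral_finsetSum _ fun i _ => hind i]
      refine Finset.sum_congr rfl fun i _ => ?_
      rw [integral_indicator_const _ measurableSet_Ico, Complex.real_smul]
    rw [hs, ← integral_sub (hf.integrable_of_hasCompactSupport hfc)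
      (integrable_finsetSum _ fun i _ => hind i)]
    refine (norm_integral_le_of_norm_le ((integrable_indicator_iff measurableSet_Ico).2
      (integrableOn_const (hfin ρ _ _))) (ae_of_all _ happ)).trans (le_of_eq ?_)
    rw [integral_indicator_const _ measurableSet_Ico, smul_eq_mul, mul_comm]
  have hsum : Tendsto (fun j => ∑ i ∈ Finset.range n,
      ((m j).real (Set.Ico (a i) (a (i + 1))) : ℂ) * f (a i)) l
      (𝓝 (∑ i ∈ Finset.range n, (m₀.real (Set.Ico (a i) (a (i + 1))) : ℂ) * f (a i))) :=
    tendsto_finsetSum _ fun i _ =>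
      ((Complex.continuous_ofReal.tendsto _).comp (h _ _ (ha (Nat.le_succ i)))).mul_const _
  filter_upwards [Metric.tendsto_nhds.1 hsum (η / 4) (by positivity),
    (h (-R) (R + 1) (by linarith [le_max_right R' 0])).eventually_lt_const (lt_add_one K)]
    with j hj1 hj2
  have hle : ∀ x ≤ K + 1, η / (4 * (K + 1)) * x ≤ η / 4 := fun x hx => by
    calc η / (4 * (K + 1)) * x ≤ η / (4 * (K + 1)) * (K + 1) := by gcongr
      _ = η / 4 := by field_simp
  have h1 := (hcomp (m j)).trans (hle _ hj2.le)
  have h2 := (hcomp m₀).trans (hle _ (by linarith))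
  rw [← dist_eq_norm] at h1 h2
  rw [dist_comm] at h2
  linarith [dist_triangle4 (∫ x, f x ∂(m j))
    (∑ i ∈ Finset.range n, ((m j).real (Set.Ico (a i) (a (i + 1))) : ℂ) * f (a i))
    (∑ i ∈ Finset.range n, (m₀.real (Set.Ico (a i) (a (i + 1))) : ℂ) * f (a i)) (∫ x, f x ∂m₀)]

/-! ### Perturbations with an exponential tail -/

section

variable {ν : Measure ℝ} {θ L : ℝ}

theorem tendsto_exp_mul_measureReal_Ici (hL : L ≠ 0)
    (htail : Asymptotics.IsEquivalent atTop (fun x : ℝ => ν.real (Set.Ici x))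
      (fun x => L * Real.exp (-θ * x))) (x : ℝ) :
    Tendsto (fun s => Real.exp (-θ * s) * ν.real (Set.Ici (x - s))) atBot
      (𝓝 (L * Real.exp (-θ * x))) := by
  have h1 := (Asymptotics.isEquivalent_iff_tendsto_one (Eventually.of_forall fun x =>
    mul_ne_zero hL (Real.exp_pos (-θ * x)).ne')).1 htail
  have h2 : Tendsto (fun s : ℝ => x - s) atBot atTop := by
    simpa [sub_eq_add_neg] using tendsto_atTop_add_const_left atBot x tendsto_neg_atBot_atTop
  have h3 := (h1.comp h2).mul_const (L * Real.exp (-θ * x))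
  rw [one_mul] at h3
  refine h3.congr fun s => ?_
  have h4 : Real.exp (-θ * x) = Real.exp (-θ * s) * Real.exp (-θ * (x - s)) := by
    rw [← Real.exp_add]; congr 1; ring
  simp only [Function.comp_apply, Pi.div_apply]
  rw [h4]
  field_simp

theorem measureReal_expIntensity_Ico (hθ : 0 < θ) {a b : ℝ} (hab : a ≤ b) :
    (expIntensity θ).real (Set.Ico a b) = Real.exp (-θ * a) - Real.exp (-θ * b) := by
  have hd : ∀ x ∈ Set.uIcc a b,
      HasDerivAt (fun x => -Real.exp (-θ * x)) (θ * Real.exp (-θ * x)) x := fun x _ => by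
    exact (((hasDerivAt_id' x).const_mul (-θ)).exp.neg).congr_deriv (by ring)
  rw [measureReal_def, expIntensity, withDensity_apply _ measurableSet_Ico,
    ← integral_eq_lintegral_of_nonneg_ae (ae_of_all _ fun x => by positivity)
      (by fun_prop : Continuous fun x => θ * Real.exp (-θ * x)).aestronglyMeasurable,
    integral_Ico_eq_integral_Ioc, ← intervalIntegral.integral_of_le hab,
    intervalIntegral.integral_eq_sub_of_hasDerivAt hd
      ((by fun_prop : Continuous fun x => θ * Real.exp (-θ * x)).intervalIntegrable _ _)]
  ring

variable [IsProbabilityMeasure ν]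

theorem exists_measureReal_Ici_le (hθ : 0 < θ)
    (htail : Asymptotics.IsEquivalent atTop (fun x : ℝ => ν.real (Set.Ici x))
      (fun x => L * Real.exp (-θ * x))) :
    ∃ C : ℝ, 0 ≤ C ∧ ∀ x, ν.real (Set.Ici x) ≤ C * Real.exp (-θ * x) := by
  obtain ⟨c, hc⟩ := htail.isBigO.bound
  obtain ⟨x₀, hx₀⟩ := eventually_atTop.1 hc
  refine ⟨max (c * |L|) (Real.exp (θ * x₀)), le_max_of_le_right (Real.exp_pos _).le, fun x => ?_⟩
  rcases le_total x₀ x with h | h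
  · have := hx₀ x h
    rw [Real.norm_of_nonneg measureReal_nonneg, norm_mul, Real.norm_eq_abs, Real.norm_eq_abs,
      abs_of_pos (Real.exp_pos _), ← mul_assoc] at this
    refine this.trans ?_
    gcongr
    exact le_max_left _ _
  · calc ν.real (Set.Ici x) ≤ 1 := measureReal_le_one
      _ ≤ Real.exp (θ * x₀) * Real.exp (-θ * x) := by
        rw [← Real.exp_add]
        exact Real.one_le_exp (by nlinarith)
      _ ≤ _ := by
        gcongr
        exact le_max_right _ _

/-- The difference between `E exp (i φ (s + Y))` and `1` for `Y` of law `ν`. -/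
def charDefect (ν : Measure ℝ) (φ : ℝ → ℝ) (s : ℝ) : ℂ :=
  ∫ y, (Complex.exp (φ (s + y) * Complex.I) - 1) ∂ν

theorem integrable_exp_mul_I {φ : ℝ → ℝ} (hφ : Measurable φ) :
    Integrable (fun y => Complex.exp (φ y * Complex.I)) ν :=
  Integrable.of_bound (by fun_prop) 1 (ae_of_all _ fun y => (Complex.norm_exp_ofReal_mul_I _).le)

theorem one_add_charDefect {φ : ℝ → ℝ} (hφ : Measurable φ) (s : ℝ) :
    1 + charDefect ν φ s = ∫ y, Complex.exp (φ (s + y) * Complex.I) ∂ν := by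
  rw [charDefect, integral_sub (integrable_exp_mul_I (φ := fun y => φ (s + y)) (by fun_prop))
    (integrable_const _)]
  simp

theorem norm_one_add_charDefect_le {φ : ℝ → ℝ} (hφ : Measurable φ) (s : ℝ) :
    ‖1 + charDefect ν φ s‖ ≤ 1 := by
  rw [one_add_charDefect hφ]
  refine (norm_integral_le_of_norm_le_const (C := 1)
    (ae_of_all _ fun y => (Complex.norm_exp_ofReal_mul_I _).le)).trans ?_
  simp

theorem re_charDefect_nonpos {φ : ℝ → ℝ} (hφ : Measurable φ) (s : ℝ) :
    (charDefect ν φ s).re ≤ 0 := by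
  have h := (Complex.re_le_norm _).trans (norm_one_add_charDefect_le (ν := ν) hφ s)
  rw [Complex.add_re, Complex.one_re] at h
  linarith

theorem measurable_charDefect {φ : ℝ → ℝ} (hφ : Measurable φ) :
    Measurable (charDefect ν φ) := by
  have : StronglyMeasurable (Function.uncurry fun s y : ℝ =>
      Complex.exp (φ (s + y) * Complex.I) - 1) :=
    Measurable.stronglyMeasurable (by unfold Function.uncurry; fun_prop)
  exact this.integral_prod_right.measurable

theorem exists_norm_charDefect_le (hθ : 0 < θ)
    (htail : Asymptotics.IsEquivalent atTop (fun x : ℝ => ν.real (Set.Ici x))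
      (fun x => L * Real.exp (-θ * x))) (φ : C_c(ℝ, ℝ)) :
    ∃ C : ℝ, 0 ≤ C ∧ ∀ s, ‖charDefect ν φ s‖ ≤ C * Real.exp (θ * s) := by
  obtain ⟨C, hC, hCx⟩ := exists_measureReal_Ici_le hθ htail
  obtain ⟨R, hR⟩ := φ.hasCompactSupport.isCompact.isBounded.subset_closedBall 0
  refine ⟨2 * (C * Real.exp (θ * R)), by positivity, fun s => ?_⟩
  have hle : ∀ y, ‖Complex.exp (φ (s + y) * Complex.I) - 1‖
      ≤ (Set.Ici (-R - s)).indicator (fun _ => (2 : ℝ)) y := fun y => by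
    by_cases hy : y ∈ Set.Ici (-R - s)
    · rw [Set.indicator_of_mem hy]
      exact norm_exp_mul_I_sub_one_le _
    · have : φ (s + y) = 0 := by
        by_contra hne
        have := hR (subset_tsupport _ hne)
        rw [mem_closedBall_zero_iff, Real.norm_eq_abs] at this
        exact hy (by rw [Set.mem_Ici]; linarith [neg_abs_le (s + y)])
      rw [Set.indicator_of_notMem hy, this]
      simp
  refine (norm_integral_le_of_norm_le ((integrable_indicator_iff measurableSet_Ici).2
    (integrable_const _).integrableOn) (ae_of_all _ hle)).trans ?_
  rw [integral_indicator_const _ measurableSet_Ici, smul_eq_mul, mul_comm]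
  calc 2 * ν.real (Set.Ici (-R - s)) ≤ 2 * (C * Real.exp (-θ * (-R - s))) := by
        gcongr; exact hCx _
    _ = 2 * (C * Real.exp (θ * R)) * Real.exp (θ * s) := by
        rw [show -θ * (-R - s) = θ * R + θ * s by ring, Real.exp_add]; ring

theorem tendsto_exp_mul_charDefect (hθ : 0 < θ) (hL : 0 < L)
    (htail : Asymptotics.IsEquivalent atTop (fun x : ℝ => ν.real (Set.Ici x))
      (fun x => L * Real.exp (-θ * x))) (φ : C_c(ℝ, ℝ)) :
    Tendsto (fun s => (Real.exp (-θ * s) : ℂ) * charDefect ν φ s) atBot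
      (𝓝 (L * ∫ x, (Complex.exp (φ x * Complex.I) - 1) ∂(expIntensity θ))) := by
  set f : ℝ → ℂ := fun x => Complex.exp (φ x * Complex.I) - 1
  have hf : Continuous f := by fun_prop
  have hfc : HasCompactSupport f :=
    φ.hasCompactSupport.comp_left (g := fun t : ℝ => Complex.exp (t * Complex.I) - 1) (by simp)
  let m : ℝ → Measure ℝ := fun s => ENNReal.ofReal (Real.exp (-θ * s)) • ν.map (s + ·)
  let m₀ : Measure ℝ := ENNReal.ofReal L • expIntensity θ
  have hνf : ∀ s, IsFiniteMeasure (m s) := fun s => Measure.smul_finite _ ENNReal.ofReal_ne_top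
  have hm₀ : IsLocallyFiniteMeasure m₀ :=
    inferInstanceAs (IsLocallyFiniteMeasure (L.toNNReal • expIntensity θ))
  have hIco : ∀ a b, a ≤ b →
      Tendsto (fun s => (m s).real (Set.Ico a b)) atBot (𝓝 (m₀.real (Set.Ico a b))) := by
    intro a b hab
    have h1 := (tendsto_exp_mul_measureReal_Ici hL.ne' htail a).sub
      (tendsto_exp_mul_measureReal_Ici hL.ne' htail b)
    convert h1 using 2 with s
    · simp only [m]
      rw [measureReal_ennreal_smul_apply, ENNReal.toReal_ofReal (Real.exp_pos _).le,
        map_measureReal_apply (measurable_const_add s) measurableSet_Ico, ← mul_sub]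
      congr 1
      rw [← measureReal_sdiff (Set.Ici_subset_Ici.2 (by linarith)) measurableSet_Ici,
        Set.Ici_sdiff_Ici]
      congr 1
      ext y
      simp only [Set.mem_preimage, Set.mem_Ico]
      constructor <;> rintro ⟨_, _⟩ <;> constructor <;> linarith
    · simp only [m₀]
      rw [measureReal_ennreal_smul_apply, ENNReal.toReal_ofReal hL.le,
        measureReal_expIntensity_Ico hθ hab, mul_sub]
  have h := tendsto_integral_of_tendsto_Ico hIco hf hfc
  convert h using 2 with s
  · simp only [m]
    rw [integral_smul_measure, ENNReal.toReal_ofReal (Real.exp_pos _).le,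
      integral_map (measurable_const_add s).aemeasurable hf.aestronglyMeasurable, Complex.real_smul]
    rfl
  · simp only [m₀]
    rw [integral_smul_measure, ENNReal.toReal_ofReal hL.le, Complex.real_smul]

theorem exists_norm_charDefect_sub_le (hθ : 0 < θ) (hL : 0 < L)
    (htail : Asymptotics.IsEquivalent atTop (fun x : ℝ => ν.real (Set.Ici x))
      (fun x => L * Real.exp (-θ * x))) (φ : C_c(ℝ, ℝ)) {η : ℝ} (hη : 0 < η) :
    ∃ ρ > 0, ∀ s, L * Real.exp (θ * s) ≤ ρ →
      ‖charDefect ν φ s - (L * Real.exp (θ * s) : ℝ) *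
        ∫ x, (Complex.exp (φ x * Complex.I) - 1) ∂(expIntensity θ)‖
          ≤ η * (L * Real.exp (θ * s)) := by
  obtain ⟨s₀, hs₀⟩ := eventually_atBot.1
    (Metric.tendsto_nhds.1 (tendsto_exp_mul_charDefect hθ hL htail φ) (η * L) (by positivity))
  refine ⟨L * Real.exp (θ * s₀), by positivity, fun s hs => ?_⟩
  have hs' : s ≤ s₀ := by
    have := Real.exp_le_exp.1 (le_of_mul_le_mul_left hs hL)
    exact le_of_mul_le_mul_left this hθ
  have h := (hs₀ s hs').le
  rw [dist_eq_norm] at h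
  have h1 : (Real.exp (θ * s) : ℂ) * Real.exp (-θ * s) = 1 := by
    rw [← Complex.ofReal_mul, ← Real.exp_add]
    simp
  set c := ∫ x, (Complex.exp (φ x * Complex.I) - 1) ∂(expIntensity θ)
  calc ‖charDefect ν φ s - (L * Real.exp (θ * s) : ℝ) * c‖
      = ‖(Real.exp (θ * s) : ℂ) * ((Real.exp (-θ * s) : ℂ) * charDefect ν φ s - L * c)‖ := by
        rw [mul_sub, ← mul_assoc, h1, one_mul]
        congr 2
        push_cast
        ring
    _ ≤ Real.exp (θ * s) * (η * L) := by
        rw [norm_mul, Complex.norm_real, Real.norm_of_nonneg (Real.exp_pos _).le]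
        gcongr
    _ = _ := by ring

end

end

section

/-! ### The perturbed particles -/

variable {Ω : Type*} {N : List ℕ → Ω → ℕ∞} {ξ : List ℕ → ℕ → Ω → ℝ} {Y : List ℕ → Ω → ℝ}
  {ν : Measure ℝ} {θ k : ℝ} {n : ℕ}

/-- The words of length `n` that are particles. -/
def particles (N : List ℕ → Ω → ℕ∞) (n : ℕ) (ω : Ω) : Set (Words n) := {u | IsParticle N ω u.1}

theorem extremalMeasure_eq_pointSum (ω : Ω) :
    extremalMeasure N ξ Y n ω
      = pointSum (particles N n ω) (fun u => position ξ ω u.1 + Y u.1 ω) := by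
  classical
  refine Measure.ext fun B hB => ?_
  refine (pointSum_apply (generation N n ω) (fun u => position ξ ω u + Y u ω) hB).trans ?_
  rw [← tsum_subtype, tsum_generation N n ω fun u => B.indicator 1 (position ξ ω u + Y u ω),
    pointSum_apply _ _ hB]
  refine tsum_congr fun u => ?_
  rw [Set.indicator_apply]
  rfl

theorem shift_extremalMeasure (m : ℝ) (ω : Ω) :
    shift (-m) (extremalMeasure N ξ Y n ω)
      = pointSum (particles N n ω) (fun u => position ξ ω u.1 + Y u.1 ω - m) := by
  rw [shift, extremalMeasure_eq_pointSum, map_pointSum _ _ (measurable_add_const _)]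
  rfl

theorem toReal_weight_of_mem {u : Words n} {ω : Ω} (hu : u ∈ particles N n ω) :
    (weight N ξ θ k u.1 ω).toReal = Real.exp (θ * position ξ ω u.1 - n * k) := by
  rw [weight, if_pos (show IsParticle N ω u.1 from hu),
    ENNReal.toReal_ofReal (Real.exp_pos _).le, logWeight, u.2]

theorem weight_ne_top (u : List ℕ) (ω : Ω) : weight N ξ θ k u ω ≠ ∞ := by
  rw [weight]
  split_ifs <;> simp

/-- The indicators of being a particle and the positions of the words of length `n`. -/
def genealogy (N : List ℕ → Ω → ℕ∞) (ξ : List ℕ → ℕ → Ω → ℝ) (n : ℕ) (ω : Ω) (u : Words n) :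
    ℝ × ℝ :=
  ((particles N n ω).indicator 1 u, position ξ ω u.1)

theorem measurable_genealogy_past : Measurable[past N ξ n] (genealogy N ξ n) := by
  have h1 : ∀ u : Words n, Measurable[past N ξ n] fun ω => genealogy N ξ n ω u := fun u => by
    have h1 := measurableSet_isParticle_past N ξ u.1
    have h2 := measurable_position_past N ξ u.1
    rw [u.2] at h1 h2
    exact Measurable.prodMk (measurable_const.indicator h1) h2
  let _ := past N ξ n
  exact measurable_pi_lambda _ h1

variable [MeasurableSpace Ω] {P : Measure Ω}

theorem measurable_position (h : IsLastProgenyModifiedBRW P N ξ Y ν) (u : List ℕ) :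
    Measurable fun ω => position ξ ω u :=
  (measurable_position_past N ξ u).mono (past_le N ξ h.measurable_offspring _) le_rfl

theorem measurableSet_mem_particles (h : IsLastProgenyModifiedBRW P N ξ Y ν) (u : Words n) :
    MeasurableSet {ω | u ∈ particles N n ω} :=
  past_le N ξ h.measurable_offspring _ _ (measurableSet_isParticle_past N ξ u.1)

theorem measurable_genealogy (h : IsLastProgenyModifiedBRW P N ξ Y ν) :
    Measurable (genealogy N ξ n) :=
  measurable_genealogy_past.mono (past_le N ξ h.measurable_offspring _) le_rfl

theorem indepFun_genealogy (h : IsLastProgenyModifiedBRW P N ξ Y ν) :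
    IndepFun (genealogy N ξ n) (fun ω (u : Words n) => Y u.1 ω) P := by
  have h1 : past N ξ n ≤ MeasurableSpace.comap (fun ω u => offspring N ξ u ω) inferInstance :=
    iSup₂_le fun v _ =>
      ((measurable_pi_apply v).comp (comap_measurable fun ω u => offspring N ξ u ω)).comap_le
  have h2 : IndepFun (genealogy N ξ n) (fun ω u => Y u ω) P :=
    (IndepFun_iff_Indep _ _ _).2 (indep_of_indep_of_le_left
      ((IndepFun_iff_Indep _ _ _).1 h.indepFun) (measurable_genealogy_past.comap_le.trans h1))
  exact h2.comp measurable_id (ψ := fun (y : List ℕ → ℝ) (u : Words n) => y u.1)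
    (measurable_pi_lambda _ fun u => measurable_pi_apply u.1)

variable [IsProbabilityMeasure P]

theorem map_genealogy_perturbation (h : IsLastProgenyModifiedBRW P N ξ Y ν)
    [IsProbabilityMeasure ν] :
    P.map (fun ω => (genealogy N ξ n ω, fun u : Words n => Y u.1 ω))
      = (P.map (genealogy N ξ n)).prod (Measure.infinitePi fun _ => ν) := by
  have hY : Measurable fun ω (u : Words n) => Y u.1 ω :=
    measurable_pi_lambda _ fun u => h.measurable_perturbation u.1
  have h1 := (h.iIndepFun_perturbation.precomp (g := fun u : Words n => u.1)
    Subtype.val_injective).map_fun_eq_infinitePi_map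
    fun u : Words n => h.measurable_perturbation u.1
  rw [(indepFun_iff_map_prod_eq_prod_map_map (measurable_genealogy h).aemeasurable
    hY.aemeasurable).1 (indepFun_genealogy h)]
  congr 1
  refine h1.trans ?_
  congr 1
  funext u
  exact h.law_perturbation u.1

/-- Integrating out the perturbations. -/
theorem integral_prod_exp_perturbation (h : IsLastProgenyModifiedBRW P N ξ Y ν)
    [IsProbabilityMeasure ν] (F : Finset (Words n)) {φ : ℝ → ℝ} (hφ : Measurable φ) (m : ℝ) :
    ∫ ω, ∏ u ∈ F, Complex.exp (((particles N n ω).indicator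
        (fun u => φ (position ξ ω u.1 + Y u.1 ω - m)) u : ℝ) * Complex.I) ∂P
      = ∫ ω, ∏ u ∈ F, (1 + (particles N n ω).indicator
          (fun u => charDefect ν φ (position ξ ω u.1 - m)) u) ∂P := by
  let H : (Words n → ℝ × ℝ) → (Words n → ℝ) → ℂ := fun x y =>
    ∏ u ∈ F, Complex.exp (((x u).1 * φ ((x u).2 - m + y u) : ℝ) * Complex.I)
  have hH : Measurable (Function.uncurry H) := by
    refine Finset.measurable_fun_prod F fun u _ => ?_
    have h1 : Measurable fun p : (Words n → ℝ × ℝ) × (Words n → ℝ) => p.1 u :=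
      (measurable_pi_apply u).comp measurable_fst
    have h2 : Measurable fun p : (Words n → ℝ × ℝ) × (Words n → ℝ) => p.2 u :=
      (measurable_pi_apply u).comp measurable_snd
    fun_prop
  have hbound : ∀ p, ‖Function.uncurry H p‖ ≤ 1 := fun p => by
    rw [Function.uncurry, norm_prod]
    exact Finset.prod_le_one (fun _ _ => norm_nonneg _)
      fun _ _ => (Complex.norm_exp_ofReal_mul_I _).le
  have hY : Measurable fun ω (u : Words n) => Y u.1 ω :=
    measurable_pi_lambda _ fun u => h.measurable_perturbation u.1
  have hX := measurable_genealogy (n := n) h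
  have : IsProbabilityMeasure (P.map (genealogy N ξ n)) :=
    Measure.isProbabilityMeasure_map hX.aemeasurable
  calc _ = ∫ ω, Function.uncurry H (genealogy N ξ n ω, fun u : Words n => Y u.1 ω) ∂P := by
        refine integral_congr_ae (ae_of_all _ fun ω => Finset.prod_congr rfl fun u _ => ?_)
        simp only [genealogy]
        rw [sub_add_eq_add_sub]
        by_cases hu : u ∈ particles N n ω <;> simp [hu]
    _ = ∫ x, ∫ y, H x y ∂(Measure.infinitePi fun _ => ν) ∂(P.map (genealogy N ξ n)) := by
        rw [← integral_map (f := Function.uncurry H) (hX.prodMk hY).aemeasurable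
          hH.aestronglyMeasurable, map_genealogy_perturbation h]
        exact integral_prod _ (Integrable.of_bound hH.aestronglyMeasurable 1 (ae_of_all _ hbound))
    _ = ∫ ω, ∫ y, H (genealogy N ξ n ω) y ∂(Measure.infinitePi fun _ => ν) ∂P :=
        integral_map hX.aemeasurable
          (hH.stronglyMeasurable.integral_prod_right
            (ν := Measure.infinitePi fun _ => ν)).aestronglyMeasurable
    _ = _ := by
        refine integral_congr_ae (ae_of_all _ fun ω => ?_)
        refine (integral_infinitePi_prod (fun _ => ν) F (f := fun u y => Complex.exp
          (((genealogy N ξ n ω u).1 * φ ((genealogy N ξ n ω u).2 - m + y) : ℝ) * Complex.I))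
          fun u => by fun_prop).trans (Finset.prod_congr rfl fun u _ => ?_)
        by_cases hu : u ∈ particles N n ω
        · simp [genealogy, hu, one_add_charDefect hφ]
        · simp [genealogy, hu]

/-! ### Local finiteness -/

theorem lintegral_extremalMeasure_Ici_le (h : IsLastProgenyModifiedBRW P N ξ Y ν)
    [IsProbabilityMeasure ν] {C : ℝ} (hC : ∀ x, ν.real (Set.Ici x) ≤ C * Real.exp (-θ * x))
    (a : ℝ) :
    ∫⁻ ω, extremalMeasure N ξ Y n ω (Set.Ici a) ∂P
      ≤ ENNReal.ofReal (C * Real.exp (n * k - θ * a)) *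
        ∫⁻ ω, weightedSum N ξ θ k (fun _ => 1) n ω ∂P := by
  have hw : ∀ u : Words n, Measurable (weight N ξ θ k u.1) := fun u =>
    (measurable_weight_past N ξ θ k u.1).mono (past_le N ξ h.measurable_offspring _) le_rfl
  have hC0 : 0 ≤ C := by
    have := measureReal_nonneg.trans (hC 0)
    simpa using this
  simp_rw [extremalMeasure_eq_pointSum, pointSum_apply _ _ measurableSet_Ici, weightedSum, mul_one]
  rw [lintegral_tsum fun u => ?_, lintegral_tsum fun u => (hw u).aemeasurable,
    ← ENNReal.tsum_mul_left]
  swap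
  · exact (Measurable.indicator ((measurable_one.indicator measurableSet_Ici).comp
      ((measurable_position h u.1).add (h.measurable_perturbation u.1)))
      (measurableSet_mem_particles h u)).aemeasurable
  refine ENNReal.tsum_le_tsum fun u => ?_
  have hX : Measurable fun ω => genealogy N ξ n ω u :=
    (measurable_pi_apply u).comp (measurable_genealogy h)
  have hind : IndepFun (fun ω => genealogy N ξ n ω u) (Y u.1) P :=
    (indepFun_genealogy h).comp (φ := fun x : Words n → ℝ × ℝ => x u)
      (ψ := fun y : Words n → ℝ => y u) (measurable_pi_apply u) (measurable_pi_apply u)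
  have hprod := (indepFun_iff_map_prod_eq_prod_map_map hX.aemeasurable
    (h.measurable_perturbation u.1).aemeasurable).1 hind
  let G : (ℝ × ℝ) × ℝ → ℝ≥0∞ := fun p =>
    ENNReal.ofReal p.1.1 * (Set.Ici a).indicator 1 (p.1.2 + p.2)
  have hG : Measurable G := by
    refine Measurable.mul (by fun_prop) ?_
    exact (measurable_one.indicator measurableSet_Ici).comp (by fun_prop)
  have hGi : ∀ x : ℝ × ℝ, ∫⁻ y, G (x, y) ∂ν
      ≤ ENNReal.ofReal x.1 * ENNReal.ofReal (C * Real.exp (-θ * (a - x.2))) := by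
    intro x
    have h1 : ∫⁻ y, (Set.Ici a).indicator 1 (x.2 + y) ∂ν = ν (Set.Ici (a - x.2)) := by
      rw [← lintegral_indicator_one measurableSet_Ici]
      refine lintegral_congr fun y => ?_
      simp only [Set.indicator_apply, Set.mem_Ici, sub_le_iff_le_add', Pi.one_apply]
    simp only [G]
    rw [lintegral_const_mul' _ _ ENNReal.ofReal_ne_top, h1, ← ofReal_measureReal]
    gcongr
    exact hC _
  calc _ = ∫⁻ ω, G (genealogy N ξ n ω u, Y u.1 ω) ∂P := by
        refine lintegral_congr fun ω => ?_
        by_cases hu : u ∈ particles N n ω <;> simp [G, genealogy, hu]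
    _ = ∫⁻ x, ∫⁻ y, G (x, y) ∂ν ∂(P.map fun ω => genealogy N ξ n ω u) := by
        rw [← lintegral_map hG (hX.prodMk (h.measurable_perturbation u.1)), hprod,
          h.law_perturbation, lintegral_prod _ hG.aemeasurable]
    _ ≤ ∫⁻ x, ENNReal.ofReal x.1 * ENNReal.ofReal (C * Real.exp (-θ * (a - x.2)))
          ∂(P.map fun ω => genealogy N ξ n ω u) := lintegral_mono hGi
    _ = ∫⁻ ω, ENNReal.ofReal (C * Real.exp (n * k - θ * a)) * weight N ξ θ k u.1 ω ∂P := by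
        rw [lintegral_map (by fun_prop) hX]
        refine lintegral_congr fun ω => ?_
        by_cases hu : u ∈ particles N n ω
        · rw [weight, if_pos (show IsParticle N ω u.1 from hu), logWeight, u.2,
            ← ENNReal.ofReal_mul (p := C * _) (by positivity), mul_assoc, ← Real.exp_add]
          simp only [genealogy, Set.indicator_of_mem hu, Pi.one_apply, ENNReal.ofReal_one, one_mul]
          congr 3
          ring
        · rw [weight, if_neg (show ¬IsParticle N ω u.1 from hu)]
          simp [genealogy, hu]
    _ = _ := lintegral_const_mul _ (hw u)

theorem ae_isPointMeasure_extremalMeasure (h : IsLastProgenyModifiedBRW P N ξ Y ν)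
    [IsProbabilityMeasure ν] [IsProbabilityMeasure (stepLaw θ k (P.map (offspring N ξ [])))]
    {C : ℝ} (hC : ∀ x, ν.real (Set.Ici x) ≤ C * Real.exp (-θ * x)) (n : ℕ) :
    ∀ᵐ ω ∂P, IsPointMeasure (extremalMeasure N ξ Y n ω) := by
  have hm : Measurable fun ω => extremalMeasure N ξ Y n ω := by
    simp_rw [extremalMeasure_eq_pointSum]
    exact measurable_pointSum (measurableSet_mem_particles h) fun u =>
      (measurable_position h u.1).add (h.measurable_perturbation u.1)
  have hfin : ∀ j : ℕ, ∀ᵐ ω ∂P, extremalMeasure N ξ Y n ω (Set.Ici (-j)) < ∞ := fun j => by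
    refine ae_lt_top (Measure.measurable_coe measurableSet_Ici |>.comp hm) ?_
    refine ((lintegral_extremalMeasure_Ici_le (k := k) h hC _).trans_lt ?_).ne
    rw [lintegral_weightedSum_one h, mul_one]
    exact ENNReal.ofReal_lt_top
  filter_upwards [ae_all_iff.2 hfin] with ω hω
  rw [extremalMeasure_eq_pointSum] at hω ⊢
  rw [isPointMeasure_pointSum_iff, isLocallyFiniteMeasure_iff_Icc]
  exact fun j => (measure_mono Set.Icc_subset_Ici_self).trans_lt (hω j)

theorem isPointMeasure_shift {μ : Measure ℝ} (h : IsPointMeasure μ) (x : ℝ) :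
    IsPointMeasure (shift x μ) := by
  refine ⟨isLocallyFiniteMeasure_iff_Icc.2 fun j => ?_, fun B hB => ?_⟩
  · have := h.1
    rw [shift, Measure.map_apply (measurable_add_const x) measurableSet_Icc]
    refine (measure_mono ?_).trans_lt (isCompact_Icc (a := -j - x) (b := j - x)).measure_lt_top
    rintro y ⟨h1, h2⟩
    constructor <;> simp only at h1 h2 <;> linarith
  · rw [shift, Measure.map_apply (measurable_add_const x) hB]
    exact h.2 _ (measurable_add_const x hB)

end

section

/-! ### The characteristic functional of the shifted extremal measures -/

variable {Ω : Type*} {N : List ℕ → Ω → ℕ∞} {ξ : List ℕ → ℕ → Ω → ℝ} {Y : List ℕ → Ω → ℝ}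
  {ν : Measure ℝ} {θ k L m : ℝ} {n : ℕ}

/-- The factor of a word in the conditional characteristic functional, minus `1`. -/
def wordDefect (N : List ℕ → Ω → ℕ∞) (ξ : List ℕ → ℕ → Ω → ℝ) (ν : Measure ℝ) (φ : ℝ → ℝ)
    (m : ℝ) (n : ℕ) (ω : Ω) : Words n → ℂ :=
  (particles N n ω).indicator fun u => charDefect ν φ (position ξ ω u.1 - m)

theorem norm_one_add_wordDefect_le [IsProbabilityMeasure ν] {φ : ℝ → ℝ} (hφ : Measurable φ)
    (ω : Ω) (u : Words n) : ‖1 + wordDefect N ξ ν φ m n ω u‖ ≤ 1 := by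
  by_cases hu : u ∈ particles N n ω
  · simpa [wordDefect, hu] using norm_one_add_charDefect_le hφ _
  · simp [wordDefect, hu]

theorem re_wordDefect_nonpos [IsProbabilityMeasure ν] {φ : ℝ → ℝ} (hφ : Measurable φ)
    (ω : Ω) (u : Words n) : (wordDefect N ξ ν φ m n ω u).re ≤ 0 := by
  by_cases hu : u ∈ particles N n ω
  · simpa [wordDefect, hu] using re_charDefect_nonpos hφ _
  · simp [wordDefect, hu]

theorem norm_wordDefect_le {φ : ℝ → ℝ} {C : ℝ}
    (hC : ∀ s, ‖charDefect ν φ s‖ ≤ C * Real.exp (θ * s)) (ω : Ω) (u : Words n) :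
    ‖wordDefect N ξ ν φ m n ω u‖
      ≤ C * Real.exp (n * k - θ * m) * (weight N ξ θ k u.1 ω).toReal := by
  by_cases hu : u ∈ particles N n ω
  · rw [wordDefect, Set.indicator_of_mem hu, toReal_weight_of_mem hu, mul_assoc, ← Real.exp_add]
    refine (hC _).trans (le_of_eq ?_)
    congr 2
    ring
  · have : weight N ξ θ k u.1 ω = 0 := if_neg hu
    simp [wordDefect, hu, this]

theorem summable_toReal_weight {ω : Ω} (hω : weightedSum N ξ θ k (fun _ => 1) n ω < ∞) :
    Summable fun u : Words n => (weight N ξ θ k u.1 ω).toReal := by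
  rw [weightedSum] at hω
  simp_rw [mul_one] at hω
  exact ENNReal.summable_toReal hω.ne

theorem tsum_toReal_weight (ω : Ω) :
    ∑' u : Words n, (weight N ξ θ k u.1 ω).toReal
      = (weightedSum N ξ θ k (fun _ => 1) n ω).toReal := by
  rw [weightedSum, ENNReal.tsum_toReal_eq fun u => ?_]
  · simp_rw [mul_one]
  · rw [mul_one]
    exact weight_ne_top _ _

theorem hasProd_wordDefect {φ : ℝ → ℝ} {C : ℝ}
    (hC : ∀ s, ‖charDefect ν φ s‖ ≤ C * Real.exp (θ * s)) {ω : Ω}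
    (hω : weightedSum N ξ θ k (fun _ => 1) n ω < ∞) :
    HasProd (fun u => 1 + wordDefect N ξ ν φ m n ω u)
      (∏' u, (1 + wordDefect N ξ ν φ m n ω u)) := by
  have h : Summable fun u => ‖wordDefect N ξ ν φ m n ω u‖ :=
    Summable.of_nonneg_of_le (fun _ => norm_nonneg _) (norm_wordDefect_le hC ω)
      ((summable_toReal_weight hω).mul_left _)
  exact (Complex.multipliable_one_add_of_summable h.of_norm).hasProd

theorem norm_tprod_wordDefect_le [IsProbabilityMeasure ν] {φ : ℝ → ℝ} (hφ : Measurable φ) {C : ℝ}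
    (hC : ∀ s, ‖charDefect ν φ s‖ ≤ C * Real.exp (θ * s)) {ω : Ω}
    (hω : weightedSum N ξ θ k (fun _ => 1) n ω < ∞) :
    ‖∏' u, (1 + wordDefect N ξ ν φ m n ω u)‖ ≤ 1 := by
  refine le_of_tendsto (hasProd_wordDefect hC hω).norm (Eventually.of_forall fun F =>
    Finset.prod_le_one (fun _ _ => norm_nonneg _) fun u _ => norm_one_add_wordDefect_le hφ ω u)

/-! ### Convergence -/

theorem tendsto_tprod_wordDefect [IsProbabilityMeasure ν] (hθ : 0 < θ) (hL : 0 < L)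
    (htail : Asymptotics.IsEquivalent atTop (fun x : ℝ => ν.real (Set.Ici x))
      (fun x => L * Real.exp (-θ * x))) (φ : C_c(ℝ, ℝ)) {ω : Ω} {ns : ℕ → ℕ} {m : ℕ → ℝ} {W : ℝ}
    (hm : ∀ n, Real.exp (n * k - θ * m n) = L⁻¹)
    (hfin : ∀ n, weightedSum N ξ θ k (fun _ => 1) n ω < ∞)
    (hmax : Tendsto (fun i => (maxWeight N ξ θ k (ns i) ω).toReal) atTop (𝓝 0))
    (hW : Tendsto (fun i => (weightedSum N ξ θ k (fun _ => 1) (ns i) ω).toReal) atTop (𝓝 W)) :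
    Tendsto (fun i => ∏' u, (1 + wordDefect N ξ ν φ (m (ns i)) (ns i) ω u)) atTop
      (𝓝 (Complex.exp (W * ∫ x, (Complex.exp (φ x * Complex.I) - 1) ∂(expIntensity θ)))) := by
  have hφ : Measurable φ := φ.continuous.measurable
  obtain ⟨C, -, hC⟩ := exists_norm_charDefect_le hθ htail φ
  have hweight : ∀ {n : ℕ} {u : Words n}, u ∈ particles N n ω →
      L * Real.exp (θ * (position ξ ω u.1 - m n)) = (weight N ξ θ k u.1 ω).toReal :=
    fun {n u} hu => by
      have h1 : θ * (position ξ ω u.1 - m n)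
          = θ * position ξ ω u.1 - n * k + (n * k - θ * m n) := by ring
      rw [toReal_weight_of_mem hu, h1, Real.exp_add, hm]
      field_simp
  refine tendsto_tprod_one_add (ι := fun i => Words (ns i))
    (w := fun i u => (weight N ξ θ k u.1 ω).toReal)
    (z := fun i => wordDefect N ξ ν φ (m (ns i)) (ns i) ω)
    (M := fun i => (maxWeight N ξ θ k (ns i) ω).toReal) (W := W) (C := C * L⁻¹)
    (fun i => norm_one_add_wordDefect_le hφ ω) (fun i => re_wordDefect_nonpos hφ ω)
    (fun _ _ => ENNReal.toReal_nonneg) (fun i u => ?_) (fun i u => ?_)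
    (fun i => summable_toReal_weight (hfin _)) hmax ?_ fun η hη => ?_
  · rw [← hm (ns i)]
    exact norm_wordDefect_le hC ω u
  · exact ENNReal.toReal_mono ((maxWeight_le_weightedSum_one _ _).trans_lt (hfin _)).ne
      (le_iSup (fun u : Words (ns i) => weight N ξ θ k u.1 ω) u)
  · simpa only [tsum_toReal_weight] using hW
  · obtain ⟨ρ, hρ, hρs⟩ := exists_norm_charDefect_sub_le hθ hL htail φ hη
    refine ⟨ρ, hρ, fun i u hu => ?_⟩
    by_cases hp : u ∈ particles N (ns i) ω
    · rw [← hweight hp] at hu ⊢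
      rw [wordDefect, Set.indicator_of_mem hp]
      exact hρs _ hu
    · have : weight N ξ θ k u.1 ω = 0 := if_neg hp
      simp [wordDefect, hp, this]

variable [MeasurableSpace Ω] {P : Measure Ω}

theorem exp_sub_mul_centring (hθ : θ ≠ 0) (hL : 0 < L) (n : ℕ) :
    Real.exp (n * (kappa P N ξ θ).toReal - θ * centring P N ξ θ L n) = L⁻¹ := by
  have h : n * (kappa P N ξ θ).toReal - θ * centring P N ξ θ L n = -Real.log L := by
    rw [centring]
    field_simp
    ring
  rw [h, Real.exp_neg, Real.exp_log hL]

theorem measurable_wordDefect (h : IsLastProgenyModifiedBRW P N ξ Y ν) [IsProbabilityMeasure ν]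
    {φ : ℝ → ℝ} (hφ : Measurable φ) (u : Words n) :
    Measurable fun ω => wordDefect N ξ ν φ m n ω u :=
  Measurable.indicator ((measurable_charDefect hφ).comp ((measurable_position h u.1).sub_const m))
    (measurableSet_mem_particles h u)

theorem aestronglyMeasurable_tprod_wordDefect (h : IsLastProgenyModifiedBRW P N ξ Y ν)
    [IsProbabilityMeasure ν] {φ : ℝ → ℝ} (hφ : Measurable φ) {C : ℝ}
    (hC : ∀ s, ‖charDefect ν φ s‖ ≤ C * Real.exp (θ * s))
    (hfin : ∀ᵐ ω ∂P, weightedSum N ξ θ k (fun _ => 1) n ω < ∞) :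
    AEStronglyMeasurable (fun ω => ∏' u, (1 + wordDefect N ξ ν φ m n ω u)) P := by
  refine aestronglyMeasurable_of_tendsto_ae atTop (f := fun (F : Finset (Words n)) ω =>
    ∏ u ∈ F, (1 + wordDefect N ξ ν φ m n ω u)) (fun F => ?_) ?_
  · exact (Finset.measurable_fun_prod F fun u _ =>
      (measurable_wordDefect h hφ u).const_add 1).aestronglyMeasurable
  · filter_upwards [hfin] with ω hω using hasProd_wordDefect hC hω

theorem measurable_toPointMeasure_shift (h : IsLastProgenyModifiedBRW P N ξ Y ν) :
    Measurable fun ω => toPointMeasure (shift (-m) (extremalMeasure N ξ Y n ω)) := by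
  simp_rw [shift_extremalMeasure]
  exact measurable_toPointMeasure_pointSum (measurableSet_mem_particles h) fun u =>
    ((measurable_position h u.1).add (h.measurable_perturbation u.1)).sub_const m

variable [IsProbabilityMeasure P]

theorem integral_exp_shift_extremalMeasure (h : IsLastProgenyModifiedBRW P N ξ Y ν)
    [IsProbabilityMeasure ν] (φ : C_c(ℝ, ℝ)) {C : ℝ}
    (hC : ∀ s, ‖charDefect ν φ s‖ ≤ C * Real.exp (θ * s))
    (hfin : ∀ᵐ ω ∂P, weightedSum N ξ θ k (fun _ => 1) n ω < ∞)
    (hpt : ∀ᵐ ω ∂P, IsPointMeasure (extremalMeasure N ξ Y n ω)) :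
    ∫ ω, Complex.exp ((∫ x, φ x ∂(toPointMeasure
        (shift (-m) (extremalMeasure N ξ Y n ω))).1 : ℝ) * Complex.I) ∂P
      = ∫ ω, ∏' u, (1 + wordDefect N ξ ν φ m n ω u) ∂P := by
  have hφ : Measurable φ := φ.continuous.measurable
  have hpos : ∀ u : Words n, Measurable fun ω => position ξ ω u.1 + Y u.1 ω - m := fun u =>
    ((measurable_position h u.1).add (h.measurable_perturbation u.1)).sub_const m
  have h1 : Tendsto (fun F : Finset (Words n) => ∫ ω, ∏ u ∈ F,
      Complex.exp (((particles N n ω).indicator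
        (fun u => φ (position ξ ω u.1 + Y u.1 ω - m)) u : ℝ) * Complex.I) ∂P) atTop
      (𝓝 (∫ ω, Complex.exp ((∫ x, φ x ∂(toPointMeasure
        (shift (-m) (extremalMeasure N ξ Y n ω))).1 : ℝ) * Complex.I) ∂P)) := by
    refine tendsto_integral_filter_of_dominated_convergence (fun _ => 1)
      (Eventually.of_forall fun F => ?_) (Eventually.of_forall fun F => ae_of_all _ fun ω => ?_)
      (integrable_const _) ?_
    · refine (Finset.measurable_fun_prod F fun u _ => ?_).aestronglyMeasurable
      exact ((Complex.measurable_ofReal.comp (Measurable.indicator (hφ.comp (hpos u))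
        (measurableSet_mem_particles h u))).mul_const _).cexp
    · rw [norm_prod]
      exact Finset.prod_le_one (fun _ _ => norm_nonneg _)
        fun _ _ => (Complex.norm_exp_ofReal_mul_I _).le
    · filter_upwards [hpt] with ω hω
      have hs := isPointMeasure_shift hω (-m)
      have hi := PointMeasure.integrable (toPointMeasure
        (shift (-m) (extremalMeasure N ξ Y n ω))) φ
      rw [toPointMeasure_val hs, shift_extremalMeasure] at hi ⊢
      have hsum := hasSum_integral_pointSum _ _ hφ hi
      have hcont : Continuous fun t : ℝ => Complex.exp (t * Complex.I) := by fun_prop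
      have := (hcont.tendsto _).comp hsum
      refine this.congr fun F => ?_
      simp only [Function.comp_apply]
      rw [Complex.ofReal_sum, Finset.sum_mul, Complex.exp_sum]
  have h2 : Tendsto (fun F : Finset (Words n) => ∫ ω, ∏ u ∈ F, (1 + wordDefect N ξ ν φ m n ω u) ∂P)
      atTop (𝓝 (∫ ω, ∏' u, (1 + wordDefect N ξ ν φ m n ω u) ∂P)) := by
    refine tendsto_integral_filter_of_dominated_convergence (fun _ => 1)
      (Eventually.of_forall fun F => ?_) (Eventually.of_forall fun F => ae_of_all _ fun ω => ?_)
      (integrable_const _) ?_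
    · exact (Finset.measurable_fun_prod F fun u _ =>
        (measurable_wordDefect h hφ u).const_add 1).aestronglyMeasurable
    · rw [norm_prod]
      exact Finset.prod_le_one (fun _ _ => norm_nonneg _)
        fun u _ => norm_one_add_wordDefect_le hφ ω u
    · filter_upwards [hfin] with ω hω using hasProd_wordDefect hC hω
  refine tendsto_nhds_unique h1 (h2.congr fun F => ?_)
  exact (integral_prod_exp_perturbation h F hφ m).symm

theorem tendsto_integral_exp_shift_extremalMeasure (h : IsLastProgenyModifiedBRW P N ξ Y ν)
    [IsProbabilityMeasure ν]
    [IsProbabilityMeasure (stepLaw θ (kappa P N ξ θ).toReal (P.map (offspring N ξ [])))]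
    (hμ : ∀ x, stepLaw θ (kappa P N ξ θ).toReal (P.map (offspring N ξ [])) {x}ᶜ ≠ 0)
    (hθ : 0 < θ) (hL : 0 < L)
    (htail : Asymptotics.IsEquivalent atTop (fun x : ℝ => ν.real (Set.Ici x))
      (fun x => L * Real.exp (-θ * x))) (φ : C_c(ℝ, ℝ)) :
    Tendsto (fun n => ∫ ω, Complex.exp ((∫ x, φ x ∂(toPointMeasure
        (shift (-centring P N ξ θ L n) (extremalMeasure N ξ Y n ω))).1 : ℝ) * Complex.I) ∂P) atTop
      (𝓝 (∫ ω, Complex.exp ((additiveLimit P N ξ θ ω).toReal *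
        ∫ x, (Complex.exp (φ x * Complex.I) - 1) ∂(expIntensity θ)) ∂P)) := by
  have hφ : Measurable φ := φ.continuous.measurable
  obtain ⟨C, -, hC⟩ := exists_norm_charDefect_le hθ htail φ
  obtain ⟨C', -, hC'⟩ := exists_measureReal_Ici_le hθ htail
  have hfin := ae_weightedSum_one_lt_top (θ := θ) (k := (kappa P N ξ θ).toReal) h
  simp_rw [fun n => integral_exp_shift_extremalMeasure (m := centring P N ξ θ L n) h φ hC (hfin n)
    (ae_isPointMeasure_extremalMeasure (k := (kappa P N ξ θ).toReal) h hC' n)]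
  refine tendsto_of_subseq_tendsto fun ns hns => ?_
  obtain ⟨ms, hms, hmax⟩ := ((tendstoInMeasure_maxWeight h hμ).comp hns).exists_seq_tendsto_ae
  refine ⟨ms, tendsto_integral_of_dominated_convergence (fun _ => 1) (fun i =>
    aestronglyMeasurable_tprod_wordDefect h hφ hC (hfin _)) (integrable_const _) (fun i => ?_) ?_⟩
  · filter_upwards [hfin (ns (ms i))] with ω hω using norm_tprod_wordDefect_le hφ hC hω
  · filter_upwards [ae_all_iff.2 hfin, hmax, ae_tendsto_additiveMartingale (θ := θ) h]
      with ω h1 h2 h3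
    refine tendsto_tprod_wordDefect hθ hL htail φ (exp_sub_mul_centring hθ.ne' hL) h1 h2 ?_
    simp_rw [← additiveMartingale_eq]
    exact ((ENNReal.tendsto_toReal h3.1.ne).comp h3.2).comp (hns.comp hms.tendsto_atTop)

end

end LPM

end

theorem theorem1p1 {Ω : Type*} [MeasurableSpace Ω] (P : Measure Ω) [IsProbabilityMeasure P]
    (N : List ℕ → Ω → ℕ∞) (ξ : List ℕ → ℕ → Ω → ℝ) (Y : List ℕ → Ω → ℝ)
    (ν : Measure ℝ) [IsProbabilityMeasure ν]
    (hBRW : LPM.IsLastProgenyModifiedBRW P N ξ Y ν)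
    -- the branching random walk is supercritical
    (hsuper : 1 < ∫⁻ ω, ((LPM.generation N 1 ω).encard : ℝ≥0∞) ∂P)
    -- the positions of the first generation are not all at one deterministic point
    (hnondeg : ∀ x : ℝ, 0 < P {ω | ∃ u ∈ LPM.generation N 1 ω, LPM.position ξ ω u ≠ x})
    (θ : ℝ) (hθ : 0 < θ) (hκ : LPM.kappa P N ξ θ < ⊤)
    (hUI : UniformIntegrable
      (fun n ω => (LPM.additiveMartingale P N ξ θ n ω).toReal) 1 P)
    (L : ℝ) (hL : 0 < L)
    (htail : Asymptotics.IsEquivalent atTop (fun x : ℝ => ν.real (Set.Ici x))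
      (fun x => L * Real.exp (-θ * x))) :
    -- `W_n(θ)` converges almost surely to the finite limit `W_∞(θ)`
    (∀ᵐ ω ∂P, LPM.additiveLimit P N ξ θ ω < ∞ ∧
      Tendsto (fun n => LPM.additiveMartingale P N ξ θ n ω) atTop
        (𝓝 (LPM.additiveLimit P N ξ θ ω))) ∧
    -- every `E_n` is almost surely a point measure
    (∀ n, ∀ᵐ ω ∂P, LPM.IsPointMeasure (LPM.extremalMeasure N ξ Y n ω)) ∧
    -- the shifted processes converge in law to `PPP(θ W_∞(θ) exp(-θ x) dx)`
    ∃ (Ω' : Type) (_ : MeasurableSpace Ω') (P' : Measure Ω') (_ : IsProbabilityMeasure P')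
      (Q : Ω' → ℝ≥0) (Z : Ω' → LPM.PointMeasure),
      IdentDistrib Q (fun ω => (LPM.additiveLimit P N ξ θ ω).toNNReal) P' P ∧
      LPM.IsCoxProcess P' Q (LPM.expIntensity θ) Z ∧
      TendstoInDistribution
        (fun n ω => LPM.toPointMeasure
          (LPM.shift (-LPM.centring P N ξ θ L n) (LPM.extremalMeasure N ξ Y n ω)))
        atTop Z (fun _ => P) P' := by

  have hprob := LPM.isProbabilityMeasure_stepLaw hBRW hnondeg hκ
  have hμ := LPM.stepLaw_compl_singleton_ne_zero (k := (LPM.kappa P N ξ θ).toReal) hBRW hnondeg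
    hθ.ne'
  obtain ⟨C, -, hC⟩ := LPM.exists_measureReal_Ici_le hθ htail
  have hlim := LPM.ae_tendsto_additiveMartingale (θ := θ) hBRW
  refine ⟨hlim, LPM.ae_isPointMeasure_extremalMeasure
    (k := (LPM.kappa P N ξ θ).toReal) hBRW hC, ?_⟩
  have hW : Measurable fun ω => (LPM.additiveLimit P N ξ θ ω).toNNReal :=
    (LPM.measurable_additiveLimit hBRW).ennreal_toNNReal
  have hρ := Measure.isProbabilityMeasure_map (μ := P) hW.aemeasurable
  obtain ⟨Ω', _, P', hP', Q, Z, hQ, hZ, hchar⟩ := LPM.exists_isCoxProcess hθ.ne'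
    (P.map fun ω => (LPM.additiveLimit P N ξ θ ω).toNNReal)
  refine ⟨Ω', _, P', hP', Q, Z, ⟨hZ.measurable_intensity.aemeasurable, hW.aemeasurable, hQ⟩, hZ,
    LPM.PointMeasure.tendstoInDistribution_of_tendsto_charFunctional
      (fun n => (LPM.measurable_toPointMeasure_shift hBRW).aemeasurable)
      hZ.measurable_process.aemeasurable fun φ => ?_⟩
  rw [hchar, integral_map hW.aemeasurable (by fun_prop)]
  exact LPM.tendsto_integral_exp_shift_extremalMeasure hBRW hμ hθ hL htail φ
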